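/- Let $F$ be a compact metric space and $m$ a finite Borel measure on $F$. A Dirichlet form on $L^2(F,m)$ is a pair $(\mathcal E,\mathcal F)$ of a dense linear subspace $\mathcal F\subset L^2(F,m)$ and a non-negative symmetric bilinear form $\mathcal E$ on $\mathcal F$ such that $\mathcal F$ is complete for the norm $\mathcal E_1(u,u)^{1/2}$, where $\mathcal E_1(u,u)=\mathcal E(u,u)+\|u\|_2^2$, and such that $u\in\mathcal F$ implies $\bar u=(0\vee u)\wedge 1\in\mathcal F$ and $\mathcal E(\bar u,\bar u)\le\mathcal E(u,u)$. Let $(T_t)_{t\ge 0}$ be the strongly continuous symmetric contraction semigroup on $L^2(F,m)$ associated with $(\mathcal E,\mathcal F)$, i.e. the one whose generator $L$ satisfies: $u\in\mathrm{dom}(L)$ and $Lu=f$ if and only if $u\in\mathcal F$ and $\mathcal E(u,v)=-\langle f,v\rangle$ for all $v\in\mathcal F$. The form is called *local* if $\mathcal E(u,v)=0$ whenever $u,v\in\mathcal F$ have disjoint (compact) supports, the support of $u$ being that of the measure $|u|\,dm$; *regular* if there is a set of continuous functions contained in $\mathcal F$ that is $\mathcal E_1$-dense in $\mathcal F$ and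 uniformly dense in $C(F)$; *conservative* if $T_t1=1$ for all $t>0$; and *irreducible* if every Borel set $A\subset F$ with $T_t(1_Au)=1_AT_tu$ for all $t>0$ and $u\in L^2(F,m)$ satisfies $m(A)=0$ or $m(F\setminus A)=0$. Theorem. Suppose that $(\mathcal A,\mathcal F)$ and $(\mathcal B,\mathcal F)$ are local, regular, conservative, irreducible Dirichlet forms on $L^2(F,m)$ with the same domain $\mathcal F$, and that $\mathcal A(u,u)\le\mathcal B(u,u)$ for all $u\in\mathcal F$. Let $\delta>0$ and $\mathcal E=(1+\delta)\mathcal B-\mathcal A$. Then $(\mathcal E,\mathcal F)$ is a local, regular, conservative, irreducible Dirichlet form on $L^2(F,m)$. -/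

import Mathlib

open MeasureTheory Filter Topology
open scoped NNReal ENNReal

noncomputable section

namespace DirichletForms

variable {X : Type*} [MeasurableSpace X]

/-- The real Hilbert space `L²(X, m)`. -/
abbrev L2 (m : Measure X) : Type _ := Lp ℝ 2 m

/-- The function `1_A u`, as an element of `L²(X, m)`. -/
def restrict {m : Measure X} {A : Set X} (hA : MeasurableSet A) (u : L2 m) : L2 m :=
  ((Lp.memLp u).indicator hA).toLp (A.indicator u)

/-- The quadratic form `E₁(u, u) = E(u, u) + ‖u‖₂²` on the domain `D` of `E`. -/
def energyOne {m : Measure X} {D : Submodule ℝ (L2 m)}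
    (E : LinearMap.BilinForm ℝ D) (u : D) : ℝ :=
  E u u + ‖(u : L2 m)‖ ^ 2

/-- `(E, D)` is a Dirichlet form on `L²(X, m)`: a densely defined, non-negative, symmetric,
closed bilinear form on which the unit contraction operates. -/
structure IsDirichletForm {m : Measure X} {D : Submodule ℝ (L2 m)}
    (E : LinearMap.BilinForm ℝ D) : Prop where
  dense : Dense (D : Set (L2 m))
  symm : ∀ u v : D, E u v = E v u
  nonneg : ∀ u : D, 0 ≤ E u u
  /-- `D` is complete with respect to the norm `E₁^{1/2}`. -/
  closed : ∀ u : ℕ → D,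
    (∀ ε : ℝ, 0 < ε → ∃ N : ℕ, ∀ i ≥ N, ∀ j ≥ N, energyOne E (u i - u j) < ε) →
    ∃ w : D, Tendsto (fun i => energyOne E (u i - w)) atTop (𝓝 0)
  /-- If `u ∈ D` then `(0 ∨ u) ∧ 1 ∈ D`, with no larger energy. -/
  markov : ∀ u : D, ∃ v : D,
    (∀ᵐ x ∂m, (v : L2 m) x = min (max 0 ((u : L2 m) x)) 1) ∧ E v v ≤ E u u

/-- The support of `u ∈ L²(X, m)`: the topological support of the measure `|u| m`. -/
def essSupport [TopologicalSpace X] {m : Measure X} (u : L2 m) : Set X :=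
  (m.withDensity fun x => ‖u x‖ₑ).support

/-- Locality: `E(u, v) = 0` whenever `u, v ∈ D` have disjoint compact supports. -/
def IsLocal [TopologicalSpace X] {m : Measure X} {D : Submodule ℝ (L2 m)}
    (E : LinearMap.BilinForm ℝ D) : Prop :=
  ∀ u v : D, IsCompact (essSupport (u : L2 m)) → IsCompact (essSupport (v : L2 m)) →
    Disjoint (essSupport (u : L2 m)) (essSupport (v : L2 m)) → E u v = 0

/-- A core of `(E, D)` over a compact space: a set of continuous functions lying in `D`, dense in
`D` for the norm `E₁^{1/2}` and dense in `C(X)` for the uniform norm. -/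
structure IsCore [TopologicalSpace X] [CompactSpace X] [BorelSpace X]
    {m : Measure X} [IsFiniteMeasure m] {D : Submodule ℝ (L2 m)}
    (E : LinearMap.BilinForm ℝ D) (C : Set C(X, ℝ)) : Prop where
  mem_domain : ∀ f ∈ C, ContinuousMap.toLp (E := ℝ) 2 m ℝ f ∈ D
  dense_domain : ∀ u : D, ∀ ε : ℝ, 0 < ε → ∃ v : D,
    (∃ f ∈ C, ContinuousMap.toLp (E := ℝ) 2 m ℝ f = (v : L2 m)) ∧ energyOne E (u - v) < ε
  dense_continuous : Dense C

/-- `(E, D)` is regular if it possesses a core. -/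
def IsRegular [TopologicalSpace X] [CompactSpace X] [BorelSpace X]
    {m : Measure X} [IsFiniteMeasure m] {D : Submodule ℝ (L2 m)}
    (E : LinearMap.BilinForm ℝ D) : Prop :=
  ∃ C : Set C(X, ℝ), IsCore E C

/-- `(T_t)_{t ≥ 0}` is the semigroup on `L²(X, m)` associated with `(E, D)`: the strongly
continuous symmetric contraction semigroup whose generator `L` is the operator of the form,
that is, `u ∈ dom L` and `L u = f` if and only if `u ∈ D` and `E(u, v) = -⟨f, v⟩` for all
`v ∈ D`. -/
structure IsSemigroupOf {m : Measure X} {D : Submodule ℝ (L2 m)}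
    (E : LinearMap.BilinForm ℝ D) (T : ℝ≥0 → L2 m →L[ℝ] L2 m) : Prop where
  zero : T 0 = ContinuousLinearMap.id ℝ (L2 m)
  add : ∀ s t : ℝ≥0, T (s + t) = (T s).comp (T t)
  symm : ∀ (t : ℝ≥0) (u v : L2 m), inner ℝ (T t u) v = inner ℝ u (T t v)
  contraction : ∀ (t : ℝ≥0) (u : L2 m), ‖T t u‖ ≤ ‖u‖
  continuous : ∀ u : L2 m, Tendsto (fun t : ℝ≥0 => T t u) (𝓝[>] 0) (𝓝 u)
  generator : ∀ u f : L2 m,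
    Tendsto (fun t : ℝ≥0 => (t : ℝ)⁻¹ • (T t u - u)) (𝓝[>] 0) (𝓝 f) ↔
      ∃ hu : u ∈ D, ∀ v : D, E ⟨u, hu⟩ v = -inner ℝ f (v : L2 m)

/-- A measurable set `A` is invariant for `(T_t)` if `T_t (1_A u) = 1_A T_t u` for all `t > 0`
and `u ∈ L²`. -/
def IsInvariantSet {m : Measure X} (T : ℝ≥0 → L2 m →L[ℝ] L2 m) {A : Set X}
    (hA : MeasurableSet A) : Prop :=
  ∀ t : ℝ≥0, 0 < t → ∀ u : L2 m, T t (restrict hA u) = restrict hA (T t u)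

/-- `(E, D)` is conservative: its semigroup satisfies `T_t 1 = 1` for all `t > 0`. -/
def IsConservative {m : Measure X} [IsFiniteMeasure m] {D : Submodule ℝ (L2 m)}
    (E : LinearMap.BilinForm ℝ D) : Prop :=
  ∃ T : ℝ≥0 → L2 m →L[ℝ] L2 m, IsSemigroupOf E T ∧
    ∀ t : ℝ≥0, 0 < t → T t (Lp.const 2 m (1 : ℝ)) = Lp.const 2 m (1 : ℝ)

/-- `(E, D)` is irreducible: every invariant set of its semigroup is null or co-null. -/
def IsIrreducible {m : Measure X} {D : Submodule ℝ (L2 m)}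
    (E : LinearMap.BilinForm ℝ D) : Prop :=
  ∃ T : ℝ≥0 → L2 m →L[ℝ] L2 m, IsSemigroupOf E T ∧
    ∀ (A : Set X) (hA : MeasurableSet A), IsInvariantSet T hA → m A = 0 ∨ m Aᶜ = 0

/-- `(E, D)` is a local, regular, conservative, irreducible Dirichlet form on `L²(X, m)`. -/
structure IsLocalRegularConservativeIrreducible [TopologicalSpace X] [CompactSpace X]
    [BorelSpace X] {m : Measure X} [IsFiniteMeasure m] {D : Submodule ℝ (L2 m)}
    (E : LinearMap.BilinForm ℝ D) : Prop where
  isDirichletForm : IsDirichletForm E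
  isLocal : IsLocal E
  isRegular : IsRegular E
  isConservative : IsConservative E
  isIrreducible : IsIrreducible E

end DirichletForms

end

/-!
The form `E = (1 + δ) B - A` satisfies `δ B ≤ E ≤ (1 + δ) B` on the common domain `D`. Hence `E` is
closed, and a core of `B` is a core of `E`. Locality is clear.

*Markov property.* Fix a local conservative Dirichlet form. The constants have no energy, so all
contractions `r ↦ (a ∨ r) ∧ b` operate (`IsDirichletForm.clamp_mem`). If `g ≥ 0` and `h` are
continuous functions in `D` with `g h = 0`, then `g` and `h` are orthogonal for the form: the
support of `(g - ε)⁺` is disjoint from that of `h`, and `ε → 0` by lower semicontinuity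
(`energy_eq_zero_of_mul_eq_zero`). Consequently the truncation `(0 ∨ f) ∧ 1` of a continuous `f` is
orthogonal to the remainder `f - (0 ∨ f) ∧ 1` (`energy_clamp_sub_eq_zero`). This holds for `A` and
for `B`, hence for `E`, so that `E` decreases under truncation of continuous functions. A general
`u ∈ D` is approximated by core functions; the truncations converge in `L²`, and lower
semicontinuity of the closed form `E` gives the inequality for `u` (`markov_combination`). In this
way no energy measures are needed.

*Semigroup.* The semigroup of a closed form is built by hand. The Riesz representation theorem in
the Hilbert space `(D, E₁)` gives the resolvent `R = (1 - L)⁻¹`, which is symmetric and injective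
with `0 ≤ R ≤ 1`. Truncating the Neumann series of `R⁻¹` in `L = 1 - R⁻¹` gives bounded
dissipative operators, which commute and converge to `L` on its domain; their exponentials
converge strongly to the semigroup (`HilbertSemigroup.IsResolvent.exists_semigroup`).
Conservativeness amounts to `L 1 = 0`, by `IsSemigroupOf.apply_eq_self`, and this property passes
from `A` and `B` to `E`.

*Irreducibility.* If a set `S` is invariant for the semigroup of `E`, then `L 1_S = 1_S L 1 = 0`, so
`E(1_S, 1_S) = 0` and thus `B(1_S, 1_S) = 0`. Adding a large multiple of `1_S` to a bounded function
and contracting shows that multiplication by `1_S` maps `D` to itself and does not increase the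
`B`-energy (`IsDirichletForm.restrictL_mem`), so it commutes with the generator of `B`, and
therefore with its semigroup (`IsSemigroupOf.apply_comm`). Hence `S` is invariant for `B`, and the
irreducibility of `B` applies.
-/

namespace HilbertSemigroup

variable {H : Type*} [NormedAddCommGroup H] [InnerProductSpace ℝ H]

/-! ### Resolvents and the approximating generators -/

theorem cauchySeq_of_dense_of_norm_le {V : ℕ → H →L[ℝ] H} (hV : ∀ n x, ‖V n x‖ ≤ ‖x‖) {s : Set H}
    (hs : Dense s) (h : ∀ x ∈ s, CauchySeq fun n => V n x) (x : H) : CauchySeq fun n => V n x := by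
  rw [Metric.cauchySeq_iff']
  intro ε hε
  obtain ⟨y, hy, hxy⟩ := Metric.mem_closure_iff.1 (hs x) (ε / 3) (by linarith)
  obtain ⟨N, hN⟩ := Metric.cauchySeq_iff'.1 (h y hy) (ε / 3) (by linarith)
  refine ⟨N, fun n hn => ?_⟩
  have h1 := hN n hn
  rw [dist_eq_norm] at h1 hxy ⊢
  have e : V n x - V N x = V n (x - y) + (V n y - V N y) - V N (x - y) := by
    simp only [map_sub]; abel
  rw [e]
  have := norm_sub_le (V n (x - y) + (V n y - V N y)) (V N (x - y))
  have := norm_add_le (V n (x - y)) (V n y - V N y)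
  linarith [hV n (x - y), hV N (x - y)]

variable {R : H →L[ℝ] H}

/-- `R` behaves like the resolvent `(1 - L)⁻¹` of a non-positive self-adjoint operator `L`: it is
symmetric and injective, and `R² ≤ R`, that is, `0 ≤ R ≤ 1`. -/
structure IsResolvent (R : H →L[ℝ] H) : Prop where
  symm : ∀ x y, inner ℝ (R x) y = inner ℝ x (R y)
  norm_sq_le : ∀ x, ‖R x‖ ^ 2 ≤ inner ℝ (R x) x
  inj : ∀ x, R x = 0 → x = 0

namespace IsResolvent

theorem norm_sq_one_sub_le (hR : IsResolvent R) (x : H) :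
    ‖(1 - R) x‖ ^ 2 ≤ inner ℝ ((1 - R) x) x := by
  have h1 : ‖(1 - R) x‖ ^ 2 = ‖x‖ ^ 2 - 2 * inner ℝ (R x) x + ‖R x‖ ^ 2 := by
    rw [sub_apply, one_apply_eq_self, norm_sub_sq_real,
      real_inner_comm]
  have h2 : inner ℝ ((1 - R) x) x = ‖x‖ ^ 2 - inner ℝ (R x) x := by
    simp [inner_sub_left]
  linarith [hR.norm_sq_le x]

theorem norm_one_sub_le (hR : IsResolvent R) (x : H) : ‖(1 - R) x‖ ≤ ‖x‖ := by
  have h1 := hR.norm_sq_one_sub_le x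
  have h2 := real_inner_le_norm ((1 - R) x) x
  by_contra! h
  nlinarith [norm_nonneg x]

theorem norm_one_sub_pow_le (hR : IsResolvent R) (n : ℕ) (x : H) : ‖((1 - R) ^ n) x‖ ≤ ‖x‖ := by
  induction n generalizing x with
  | zero => simp
  | succ n ih =>
    rw [pow_succ, mul_apply_eq_comp]
    exact (ih _).trans (hR.norm_one_sub_le x)

theorem one_sub_pow_symm (hR : IsResolvent R) (n : ℕ) (x y : H) :
    inner ℝ (((1 - R) ^ n) x) y = inner ℝ x (((1 - R) ^ n) y) := by
  induction n generalizing x y with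
  | zero => simp
  | succ n ih =>
    rw [pow_succ, mul_apply_eq_comp, ih, ← pow_succ, pow_succ',
      mul_apply_eq_comp]
    simp [inner_sub_left, inner_sub_right, hR.symm]

theorem inner_one_sub_pow_nonneg (hR : IsResolvent R) (n : ℕ) (x : H) :
    0 ≤ inner ℝ (((1 - R) ^ n) x) x := by
  obtain ⟨k, hk | hk⟩ := Nat.even_or_odd' n
  · rw [hk, two_mul, pow_add, mul_apply_eq_comp, hR.one_sub_pow_symm]
    exact real_inner_self_nonneg
  · rw [hk, two_mul, add_assoc, pow_add, mul_apply_eq_comp, hR.one_sub_pow_symm,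
      pow_succ', mul_apply_eq_comp]
    exact (sq_nonneg _).trans (hR.norm_sq_one_sub_le _)

/-- The bounded approximations `-∑_{k < n} (1 - R)^{k + 1}` of the generator `1 - R⁻¹`, obtained
by truncating the Neumann series of `R⁻¹ = (1 - (1 - R))⁻¹`. -/
noncomputable def approxGenerator (R : H →L[ℝ] H) (n : ℕ) : H →L[ℝ] H :=
  -∑ k ∈ Finset.range n, (1 - R) ^ (k + 1)

theorem approxGenerator_commute (n k : ℕ) :
    Commute (approxGenerator R n) (approxGenerator R k) := by
  refine Commute.neg_left (Commute.neg_right ?_)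
  exact Commute.sum_left _ _ _ fun i _ => Commute.sum_right _ _ _ fun j _ =>
    (Commute.refl (1 - R)).pow_pow _ _

theorem approxGenerator_symm (hR : IsResolvent R) (n : ℕ) (x y : H) :
    inner ℝ (approxGenerator R n x) y = inner ℝ x (approxGenerator R n y) := by
  simp only [approxGenerator, neg_apply, sum_apply, sum_inner, inner_sum,
    hR.one_sub_pow_symm, inner_neg_left, inner_neg_right]

theorem inner_approxGenerator_nonpos (hR : IsResolvent R) (n : ℕ) (x : H) :
    inner ℝ (approxGenerator R n x) x ≤ 0 := by
  simp only [approxGenerator, neg_apply, sum_apply,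
    inner_neg_left, sum_inner, neg_nonpos]
  exact Finset.sum_nonneg fun k _ => hR.inner_one_sub_pow_nonneg _ _

theorem approxGenerator_apply_range (n : ℕ) (x : H) :
    approxGenerator R n (R x) = ((1 - R) ^ (n + 1)) x - (1 - R) x := by
  induction n with
  | zero => simp [approxGenerator]
  | succ n ih =>
    have e : approxGenerator R (n + 1) = approxGenerator R n - (1 - R) ^ (n + 1) := by
      simp [approxGenerator, Finset.sum_range_succ, sub_eq_add_neg, add_comm]
    rw [e, sub_apply, ih, pow_succ _ (n + 1), mul_apply_eq_comp,
      sub_apply 1 R x, map_sub]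
    simp only [one_apply_eq_self]
    abel

end IsResolvent

/-! ### The semigroup generated by a resolvent -/

variable [CompleteSpace H]

theorem norm_exp_smul_le_of_dissipative {K : H →L[ℝ] H} (hK : ∀ x, inner ℝ (K x) x ≤ 0) {t : ℝ}
    (ht : 0 ≤ t) (x : H) : ‖NormedSpace.exp (t • K) x‖ ≤ ‖x‖ := by
  have hd : ∀ s : ℝ, HasDerivAt (fun s : ℝ => NormedSpace.exp (s • K) x)
      (K (NormedSpace.exp (s • K) x)) s := fun s => by
    simpa using (hasDerivAt_exp_smul_const' (𝕂 := ℝ) K s).clm_apply (hasDerivAt_const s x)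
  have hanti : Antitone (fun s : ℝ => ‖NormedSpace.exp (s • K) x‖ ^ 2) := by
    refine antitone_of_deriv_nonpos (fun s => (hd s).norm_sq.differentiableAt) fun s => ?_
    rw [(hd s).norm_sq.deriv, real_inner_comm]
    linarith [hK (NormedSpace.exp (s • K) x)]
  have h := hanti ht
  simp only [zero_smul, NormedSpace.exp_zero, one_apply_eq_self] at h
  exact le_of_sq_le_sq h (norm_nonneg _)

/-- The estimate behind the convergence of the approximating semigroups: for commuting dissipative
generators it suffices to compare the generators on the initial vector. -/
theorem norm_exp_smul_sub_exp_smul_le {K L : H →L[ℝ] H} (hKL : Commute K L)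
    (hK : ∀ x, inner ℝ (K x) x ≤ 0) (hL : ∀ x, inner ℝ (L x) x ≤ 0) {t : ℝ} (ht : 0 ≤ t) (x : H) :
    ‖NormedSpace.exp (t • K) x - NormedSpace.exp (t • L) x‖ ≤ t * ‖K x - L x‖ := by
  -- The path `s ↦ exp (s K) exp ((t - s) L) x` joins the two vectors.
  have hpath : ∀ s : ℝ, NormedSpace.exp (t • L) * NormedSpace.exp (s • (K - L)) =
      NormedSpace.exp (s • K) * NormedSpace.exp ((t - s) • L) := fun s => by
    let +nondep : NormedAlgebra ℚ (H →L[ℝ] H) := .restrictScalars ℚ ℝ _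
    rw [← NormedSpace.exp_add_of_commute, ← NormedSpace.exp_add_of_commute]
    · congr 1; module
    · exact (hKL.smul_left _).smul_right _
    · exact ((hKL.symm.sub_right (Commute.refl L)).smul_left _).smul_right _
  have hd : ∀ s : ℝ, HasDerivAt
      (fun s : ℝ => NormedSpace.exp (t • L) (NormedSpace.exp (s • (K - L)) x))
      ((NormedSpace.exp (t • L) * NormedSpace.exp (s • (K - L))) ((K - L) x)) s := fun s => by
    have h := (hasDerivAt_exp_smul_const (𝕂 := ℝ) (K - L) s).clm_apply (hasDerivAt_const s x)
    simpa [Function.comp_def] using (NormedSpace.exp (t • L)).hasFDerivAt.comp_hasDerivAt s h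
  have hb : ∀ s ∈ Set.Ico 0 t,
      ‖(NormedSpace.exp (t • L) * NormedSpace.exp (s • (K - L))) ((K - L) x)‖ ≤ ‖K x - L x‖ := by
    intro s hs
    rw [hpath]
    exact (norm_exp_smul_le_of_dissipative hK hs.1 _).trans
      (norm_exp_smul_le_of_dissipative hL (by linarith [hs.2]) _)
  have h := norm_image_sub_le_of_norm_deriv_le_segment'
    (fun s _ => (hd s).hasDerivWithinAt) hb t ⟨ht, le_rfl⟩
  have e1 := congrArg (fun f : H →L[ℝ] H => f x) (hpath t)
  simp only [sub_self, zero_smul, NormedSpace.exp_zero, mul_one,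
    mul_apply_eq_comp] at e1
  simp only [e1, zero_smul, NormedSpace.exp_zero, one_apply_eq_self, sub_zero] at h
  rwa [mul_comm] at h

/-- A symmetric injective operator has dense range. -/
theorem denseRange_of_symmetric_of_injective (hsymm : ∀ x y, inner ℝ (R x) y = inner ℝ x (R y))
    (hinj : ∀ x, R x = 0 → x = 0) : DenseRange R := by
  have h : (LinearMap.range (R : H →ₗ[ℝ] H))ᗮ = ⊥ := by
    rw [eq_bot_iff]
    intro x hx
    refine hinj x (inner_self_eq_zero (𝕜 := ℝ).1 ?_)
    rw [← hsymm]
    exact (Submodule.mem_orthogonal _ _).1 hx _ ⟨R x, rfl⟩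
  have h2 := (Submodule.topologicalClosure_eq_top_iff (K := LinearMap.range (R : H →ₗ[ℝ] H))).2 h
  rw [Submodule.dense_iff_topologicalClosure_eq_top.symm] at h2
  exact h2

namespace IsResolvent

/-- `‖(1 - R)ⁿ y‖²` decreases by at least `‖(1 - R)ⁿ R y‖²` at each step, so `(1 - R)ⁿ R y → 0`;
since the range of `R` is dense and `R` is injective, this extends to all vectors. -/
theorem tendsto_one_sub_pow (hR : IsResolvent R) (x : H) :
    Tendsto (fun n : ℕ => ((1 - R) ^ n) x) atTop (𝓝 0) := by
  set S : H →L[ℝ] H := 1 - R with hS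
  have hdiff : ∀ y, ‖R y‖ ^ 2 ≤ ‖y‖ ^ 2 - ‖S y‖ ^ 2 := fun y => by
    have h2 := norm_sub_sq_real y (R y)
    rw [real_inner_comm] at h2
    have h3 := hR.norm_sq_le y
    rw [hS, sub_apply, one_apply_eq_self]
    linarith
  have hcomm : Commute R S := (Commute.one_right R).sub_right (Commute.refl R)
  have hrange : ∀ y, Tendsto (fun n => (S ^ n) (R y)) atTop (𝓝 0) := fun y => by
    have hanti : Antitone fun n : ℕ => ‖(S ^ n) y‖ ^ 2 := antitone_nat_of_succ_le fun n => by
      rw [pow_succ' S, mul_apply_eq_comp]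
      linarith [hdiff ((S ^ n) y), sq_nonneg ‖R ((S ^ n) y)‖]
    have hlim := tendsto_atTop_ciInf hanti ⟨0, by rintro _ ⟨n, rfl⟩; positivity⟩
    have hz := hlim.sub (hlim.comp (tendsto_add_atTop_nat 1))
    rw [sub_self] at hz
    have hsq : Tendsto (fun n => ‖(S ^ n) (R y)‖ ^ 2) atTop (𝓝 0) := by
      refine squeeze_zero (fun n => sq_nonneg _) (fun n => ?_) hz
      have e : (S ^ n) (R y) = R ((S ^ n) y) :=
        congrArg (fun f : H →L[ℝ] H => f y) (hcomm.symm.pow_left n).eq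
      simp only [Function.comp_apply]
      rw [e, pow_succ' S n, mul_apply_eq_comp]
      exact hdiff _
    have := hsq.sqrt
    simp only [Real.sqrt_sq (norm_nonneg _), Real.sqrt_zero] at this
    exact tendsto_zero_iff_norm_tendsto_zero.2 this
  have hc := cauchySeq_of_dense_of_norm_le (V := fun n => S ^ n) hR.norm_one_sub_pow_le
    (denseRange_of_symmetric_of_injective hR.symm hR.inj)
    (by rintro _ ⟨y, rfl⟩; exact (hrange y).cauchySeq) x
  obtain ⟨z, hz⟩ := cauchySeq_tendsto_of_complete hc
  -- The limit is a fixed point of `1 - R`, so it vanishes.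
  have hz' : Tendsto (fun n => (S ^ (n + 1)) x) atTop (𝓝 (S z)) := by
    simp only [pow_succ', mul_apply_eq_comp]
    exact (S.continuous.tendsto z).comp hz
  have : S z = z := tendsto_nhds_unique hz' (hz.comp (tendsto_add_atTop_nat 1))
  rw [hS, sub_apply, one_apply_eq_self, sub_eq_self] at this
  rwa [hR.inj z this] at hz

theorem tendsto_approxGenerator (hR : IsResolvent R) (x : H) :
    Tendsto (fun n => approxGenerator R n (R x)) atTop (𝓝 (R x - x)) := by
  simp only [approxGenerator_apply_range]
  have e : R x - x = 0 - (1 - R) x := by simp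
  rw [e]
  exact ((hR.tendsto_one_sub_pow x).comp (tendsto_add_atTop_nat 1)).sub_const ((1 - R) x)

theorem norm_exp_approxGenerator_le (hR : IsResolvent R) (t : ℝ≥0) (n : ℕ) (x : H) :
    ‖NormedSpace.exp ((t : ℝ) • approxGenerator R n) x‖ ≤ ‖x‖ :=
  norm_exp_smul_le_of_dissipative (hR.inner_approxGenerator_nonpos n) t.2 x

theorem cauchySeq_exp_approxGenerator (hR : IsResolvent R) (t : ℝ≥0) (x : H) :
    CauchySeq fun n => NormedSpace.exp ((t : ℝ) • approxGenerator R n) x := by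
  refine cauchySeq_of_dense_of_norm_le (V := fun n => NormedSpace.exp _)
    (hR.norm_exp_approxGenerator_le t) (denseRange_of_symmetric_of_injective hR.symm hR.inj) ?_ x
  rintro _ ⟨y, rfl⟩
  rw [Metric.cauchySeq_iff']
  intro ε hε
  obtain ⟨N, hN⟩ := Metric.cauchySeq_iff'.1 (hR.tendsto_approxGenerator y).cauchySeq
    (ε / (t + 1)) (by positivity)
  refine ⟨N, fun n hn => ?_⟩
  have h := hN n hn
  rw [dist_eq_norm, lt_div_iff₀ (by positivity)] at h
  rw [dist_eq_norm]
  refine (norm_exp_smul_sub_exp_smul_le (approxGenerator_commute n N)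
    (hR.inner_approxGenerator_nonpos n) (hR.inner_approxGenerator_nonpos N) t.2 _).trans_lt ?_
  refine lt_of_le_of_lt ?_ h
  rw [mul_comm]
  gcongr
  exact le_add_of_nonneg_right zero_le_one

theorem exp_approxGenerator_symm (hR : IsResolvent R) (t : ℝ) (n : ℕ) (u v : H) :
    inner ℝ (NormedSpace.exp (t • approxGenerator R n) u) v =
      inner ℝ u (NormedSpace.exp (t • approxGenerator R n) v) := by
  have h : IsSelfAdjoint (t • approxGenerator R n) :=
    ContinuousLinearMap.isSelfAdjoint_iff_isSymmetric.2 fun x y => by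
      simpa [inner_smul_left, inner_smul_right] using Or.inl (hR.approxGenerator_symm n x y)
  have h2 : IsSelfAdjoint (NormedSpace.exp (t • approxGenerator R n)) := by
    let +nondep : NormedAlgebra ℚ (H →L[ℝ] H) := .restrictScalars ℚ ℝ _
    exact h.exp
  exact ContinuousLinearMap.isSelfAdjoint_iff_isSymmetric.1 h2 u v

theorem exp_add_smul_approxGenerator (s t : ℝ) (n : ℕ) (x : H) :
    NormedSpace.exp ((s + t) • approxGenerator R n) x =
      NormedSpace.exp (s • approxGenerator R n) (NormedSpace.exp (t • approxGenerator R n) x) := by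
  let +nondep : NormedAlgebra ℚ (H →L[ℝ] H) := .restrictScalars ℚ ℝ _
  rw [add_smul, NormedSpace.exp_add_of_commute
    (((Commute.refl _).smul_left _).smul_right _), mul_apply_eq_comp]

/-- A resolvent `R` generates a strongly continuous symmetric contraction semigroup, whose
generator `L` is given by `L u = f ↔ u = R (u - f)`. -/
theorem exists_semigroup (hR : IsResolvent R) : ∃ T : ℝ≥0 → H →L[ℝ] H,
    T 0 = ContinuousLinearMap.id ℝ H ∧
    (∀ s t : ℝ≥0, T (s + t) = (T s).comp (T t)) ∧
    (∀ (t : ℝ≥0) (u v : H), inner ℝ (T t u) v = inner ℝ u (T t v)) ∧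
    (∀ (t : ℝ≥0) (u : H), ‖T t u‖ ≤ ‖u‖) ∧
    (∀ u : H, Tendsto (fun t : ℝ≥0 => T t u) (𝓝[>] 0) (𝓝 u)) ∧
    (∀ u f : H, Tendsto (fun t : ℝ≥0 => (t : ℝ)⁻¹ • (T t u - u)) (𝓝[>] 0) (𝓝 f) ↔
      u = R (u - f)) := by
  choose T₀ hT₀ using fun (t : ℝ≥0) (x : H) =>
    cauchySeq_tendsto_of_complete (hR.cauchySeq_exp_approxGenerator t x)
  let T : ℝ≥0 → H →L[ℝ] H := fun t => LinearMap.mkContinuous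
    { toFun := T₀ t
      map_add' := fun x y => tendsto_nhds_unique (hT₀ t (x + y)) (by
        simpa only [map_add] using (hT₀ t x).add (hT₀ t y))
      map_smul' := fun c x => tendsto_nhds_unique (hT₀ t (c • x)) (by
        simpa only [map_smul, RingHom.id_apply] using (hT₀ t x).const_smul c) } 1 fun x => by
      rw [one_mul]
      exact le_of_tendsto (hT₀ t x).norm
        (Eventually.of_forall fun n => hR.norm_exp_approxGenerator_le t n x)
  have hT : ∀ (t : ℝ≥0) (x : H),
      Tendsto (fun n => NormedSpace.exp ((t : ℝ) • approxGenerator R n) x) atTop (𝓝 (T t x)) := hT₀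
  have hcontr : ∀ (t : ℝ≥0) (u : H), ‖T t u‖ ≤ ‖u‖ := fun t u =>
    le_of_tendsto (hT t u).norm
      (Eventually.of_forall fun n => hR.norm_exp_approxGenerator_le t n u)
  have hzero : ∀ x, T 0 x = x := fun x => tendsto_nhds_unique (hT 0 x) (by simp)
  have happrox : ∀ (t : ℝ≥0) (n : ℕ) (x : H),
      ‖T t (R x) - NormedSpace.exp ((t : ℝ) • approxGenerator R n) (R x)‖ ≤
        t * ‖(R x - x) - approxGenerator R n (R x)‖ := fun t n x =>
    le_of_tendsto_of_tendsto ((hT t (R x)).sub_const _).norm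
      (((hR.tendsto_approxGenerator x).sub_const _).norm.const_mul _)
      (Eventually.of_forall fun k => norm_exp_smul_sub_exp_smul_le (approxGenerator_commute k n)
        (hR.inner_approxGenerator_nonpos k) (hR.inner_approxGenerator_nonpos n) t.2 _)
  have hderiv : ∀ x, Tendsto (fun t : ℝ≥0 => (t : ℝ)⁻¹ • (T t (R x) - R x)) (𝓝[>] 0)
      (𝓝 (R x - x)) := fun x => by
    rw [Metric.tendsto_nhds]
    intro ε hε
    obtain ⟨n, hn⟩ := ((Metric.tendsto_nhds.1 (hR.tendsto_approxGenerator x)) (ε / 3)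
      (by linarith)).exists
    have hd : HasDerivAt (fun s : ℝ => NormedSpace.exp (s • approxGenerator R n) (R x))
        (approxGenerator R n (R x)) 0 := by
      simpa using (hasDerivAt_exp_smul_const (𝕂 := ℝ) (approxGenerator R n) 0).clm_apply
        (hasDerivAt_const (0 : ℝ) (R x))
    have hd' := hd.tendsto_slope_zero_right
    simp only [zero_add, zero_smul, NormedSpace.exp_zero, one_apply_eq_self] at hd'
    have hcoe : Tendsto (fun t : ℝ≥0 => (t : ℝ)) (𝓝[>] 0) (𝓝[>] 0) :=
      tendsto_nhdsWithin_of_tendsto_nhds_of_eventually_within _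
        ((NNReal.continuous_coe.tendsto 0).mono_left nhdsWithin_le_nhds)
        (eventually_nhdsWithin_of_forall fun t ht => NNReal.coe_pos.2 ht)
    filter_upwards [(Metric.tendsto_nhds.1 (hd'.comp hcoe)) (ε / 3) (by linarith),
      self_mem_nhdsWithin] with t ht htpos
    have htpos : (0 : ℝ) < t := NNReal.coe_pos.2 htpos
    have hA := happrox t n x
    rw [dist_eq_norm] at hn ht ⊢
    rw [norm_sub_rev] at hn
    simp only [Function.comp_apply] at ht
    set W := NormedSpace.exp ((t : ℝ) • approxGenerator R n) (R x)
    have hA' : ‖(t : ℝ)⁻¹ • (T t (R x) - W)‖ ≤ ‖(R x - x) - approxGenerator R n (R x)‖ := by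
      rw [norm_smul, norm_inv, Real.norm_of_nonneg htpos.le, inv_mul_le_iff₀ htpos]
      exact hA
    have e : (t : ℝ)⁻¹ • (T t (R x) - R x) - (R x - x) = (t : ℝ)⁻¹ • (T t (R x) - W) +
        ((t : ℝ)⁻¹ • (W - R x) - approxGenerator R n (R x)) -
        ((R x - x) - approxGenerator R n (R x)) := by module
    rw [e]
    refine (norm_sub_le _ _).trans_lt ?_
    have := norm_add_le ((t : ℝ)⁻¹ • (T t (R x) - W))
      ((t : ℝ)⁻¹ • (W - R x) - approxGenerator R n (R x))
    linarith
  have hcoe0 : Tendsto (fun t : ℝ≥0 => (t : ℝ)) (𝓝[>] 0) (𝓝 0) :=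
    (NNReal.continuous_coe.tendsto 0).mono_left nhdsWithin_le_nhds
  have hsymm : ∀ (t : ℝ≥0) (u v : H), inner ℝ (T t u) v = inner ℝ u (T t v) := fun t u v => by
    refine tendsto_nhds_unique ((hT t u).inner tendsto_const_nhds) ?_
    simp only [hR.exp_approxGenerator_symm]
    exact tendsto_const_nhds.inner (hT t v)
  refine ⟨T, ContinuousLinearMap.ext hzero, fun s t => ?_, hsymm, hcontr, fun u => ?_,
    fun u f => ⟨fun h => ?_, fun h => ?_⟩⟩
  · ext x
    refine tendsto_nhds_unique (hT (s + t) x) ?_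
    simp only [NNReal.coe_add, exp_add_smul_approxGenerator]
    rw [ContinuousLinearMap.comp_apply, tendsto_iff_norm_sub_tendsto_zero]
    have h1 := tendsto_iff_norm_sub_tendsto_zero.1 (hT t x)
    have h2 := tendsto_iff_norm_sub_tendsto_zero.1 (hT s (T t x))
    refine squeeze_zero (fun n => norm_nonneg _) (fun n => ?_) (by simpa using h1.add h2)
    have h3 := hR.norm_exp_approxGenerator_le s n
      (NormedSpace.exp ((t : ℝ) • approxGenerator R n) x - T t x)
    rw [map_sub] at h3
    exact (norm_sub_le_norm_sub_add_norm_sub _ _ _).trans (add_le_add h3 le_rfl)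
  · rw [Metric.tendsto_nhds]
    intro ε hε
    obtain ⟨_, ⟨y, rfl⟩, hy⟩ := Metric.mem_closure_iff.1
      (denseRange_of_symmetric_of_injective hR.symm hR.inj u) (ε / 3) (by linarith)
    have h1 := hcoe0.smul (hderiv y)
    rw [zero_smul] at h1
    filter_upwards [(Metric.tendsto_nhds.1 h1) (ε / 3) (by linarith),
      self_mem_nhdsWithin] with t ht htpos
    have htpos : (0 : ℝ) < t := NNReal.coe_pos.2 htpos
    rw [dist_eq_norm] at ht hy ⊢
    rw [smul_inv_smul₀ htpos.ne', sub_zero] at ht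
    have e : T t u - u = T t (u - R y) + (T t (R y) - R y) - (u - R y) := by
      rw [map_sub]; abel
    rw [e]
    have := norm_sub_le (T t (u - R y) + (T t (R y) - R y)) (u - R y)
    have := norm_add_le (T t (u - R y)) (T t (R y) - R y)
    linarith [hcontr t (u - R y)]
  · -- The generator is dissipative, so `1` is not an eigenvalue; apply this to `u - R (u - f)`.
    set w := u - R (u - f) with hw
    have h1 : Tendsto (fun t : ℝ≥0 => (t : ℝ)⁻¹ • (T t w - w)) (𝓝[>] 0) (𝓝 w) := by
      have := h.sub (hderiv (u - f))
      have e : f - (R (u - f) - (u - f)) = w := by rw [hw]; abel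
      rw [e] at this
      refine this.congr fun t => ?_
      rw [hw, map_sub (T t)]; module
    have h2 : inner ℝ w w ≤ 0 := by
      refine le_of_tendsto (h1.inner (tendsto_const_nhds (x := w)))
        (Eventually.of_forall fun t => ?_)
      rw [inner_smul_left, inner_sub_left, real_inner_self_eq_norm_sq]
      have := real_inner_le_norm (T t w) w
      have := mul_le_mul_of_nonneg_right (hcontr t w) (norm_nonneg w)
      refine mul_nonpos_of_nonneg_of_nonpos (by simp) (by nlinarith)
    exact sub_eq_zero.1 (inner_self_eq_zero (𝕜 := ℝ).1 (h2.antisymm real_inner_self_nonneg))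
  · have h3 := hderiv (u - f)
    rw [← h] at h3
    simpa using h3

end IsResolvent

end HilbertSemigroup

/-! ### Closed forms: the form domain, the resolvent and lower semicontinuity -/

namespace DirichletForms

variable {X : Type*} [MeasurableSpace X] {m : Measure X} {D : Submodule ℝ (L2 m)}
  {E : LinearMap.BilinForm ℝ D}

/-- The graph of the operator `L` of the form `E`: `u ∈ dom L` and `L u = f`. -/
def GeneratorGraph (E : LinearMap.BilinForm ℝ D) (u f : L2 m) : Prop :=
  ∃ hu : u ∈ D, ∀ v : D, E ⟨u, hu⟩ v = -inner ℝ f (v : L2 m)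

/-- A symmetric non-negative form whose domain is complete for `E₁^{1/2}`: a Dirichlet form
without the density of the domain and the Markov property. -/
structure IsClosedForm (E : LinearMap.BilinForm ℝ D) : Prop where
  symm : ∀ u v : D, E u v = E v u
  nonneg : ∀ u : D, 0 ≤ E u u
  closed : ∀ u : ℕ → D,
    (∀ ε : ℝ, 0 < ε → ∃ N : ℕ, ∀ i ≥ N, ∀ j ≥ N, energyOne E (u i - u j) < ε) →
    ∃ w : D, Tendsto (fun i => energyOne E (u i - w)) atTop (𝓝 0)

theorem IsDirichletForm.isClosedForm (hE : IsDirichletForm E) : IsClosedForm E :=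
  ⟨hE.symm, hE.nonneg, hE.closed⟩

/-- The domain `D` of a closed form `E`, as a Hilbert space for the inner product
`E₁(u, v) = E(u, v) + ⟨u, v⟩`. It is a copy of `D`, because `D` already carries the norm of
`L²`. -/
def FormDomain (_ : IsClosedForm E) : Type _ := D

namespace FormDomain

variable (hE : IsClosedForm E)

instance : AddCommGroup (FormDomain hE) := inferInstanceAs (AddCommGroup D)

instance : Module ℝ (FormDomain hE) := inferInstanceAs (Module ℝ D)

/-- The inner product `E₁` on the domain of a closed form. -/
@[reducible] noncomputable def core : InnerProductSpace.Core ℝ (FormDomain hE) where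
  inner (u v : D) := E u v + inner ℝ (u : L2 m) (v : L2 m)
  conj_inner_symm (u v : D) := by
    simp only [conj_trivial]
    rw [hE.symm, real_inner_comm]
  re_inner_nonneg (u : D) := add_nonneg (hE.nonneg u) real_inner_self_nonneg
  add_left (u v w : D) := by
    change E (u + v) w + inner ℝ ((u + v : D) : L2 m) (w : L2 m) = _
    rw [map_add, LinearMap.add_apply, Submodule.coe_add, inner_add_left]
    ring
  smul_left (u v : D) (r : ℝ) := by
    change E (r • u) v + inner ℝ ((r • u : D) : L2 m) (v : L2 m) = _
    rw [map_smul, LinearMap.smul_apply, Submodule.coe_smul, inner_smul_left, smul_eq_mul]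
    simp only [conj_trivial]
    ring
  definite (u : D) (h : E u u + inner ℝ (u : L2 m) (u : L2 m) = 0) := by
    have h1 : inner ℝ (u : L2 m) (u : L2 m) = 0 :=
      le_antisymm (by linarith [hE.nonneg u]) real_inner_self_nonneg
    exact Subtype.ext (inner_self_eq_zero.1 h1)

noncomputable instance : NormedAddCommGroup (FormDomain hE) := (core hE).toNormedAddCommGroup

noncomputable instance : InnerProductSpace ℝ (FormDomain hE) :=
  InnerProductSpace.ofCore (core hE).toCore

theorem inner_def (u v : FormDomain hE) :
    inner ℝ u v = E (show D from u) (show D from v) +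
      inner ℝ ((show D from u : D) : L2 m) ((show D from v : D) : L2 m) := rfl

theorem norm_sq (u : FormDomain hE) : ‖u‖ ^ 2 = energyOne E (show D from u) := by
  rw [← real_inner_self_eq_norm_sq, inner_def, real_inner_self_eq_norm_sq]
  rfl

theorem norm_coe_le (u : FormDomain hE) : ‖((show D from u : D) : L2 m)‖ ≤ ‖u‖ := by
  refine le_of_sq_le_sq ?_ (norm_nonneg _)
  rw [norm_sq, energyOne]
  linarith [hE.nonneg (show D from u)]

instance : CompleteSpace (FormDomain hE) := by
  refine Metric.complete_of_cauchySeq_tendsto fun u hu => ?_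
  obtain ⟨w, hw⟩ := hE.closed u fun ε hε => by
    obtain ⟨N, hN⟩ := Metric.cauchySeq_iff.1 hu (√ε) (Real.sqrt_pos.2 hε)
    refine ⟨N, fun i hi j hj => ?_⟩
    have h := hN i hi j hj
    rw [dist_eq_norm, Real.lt_sqrt (norm_nonneg _), norm_sq] at h
    exact h
  refine ⟨w, tendsto_iff_norm_sub_tendsto_zero.2 ?_⟩
  have h : Tendsto (fun i => ‖u i - (show FormDomain hE from w)‖ ^ 2) atTop (𝓝 0) := by
    simp only [norm_sq]
    exact hw
  simpa using h.sqrt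

/-- The inclusion of the domain of a closed form into `L²`. -/
noncomputable def incl : FormDomain hE →L[ℝ] L2 m :=
  LinearMap.mkContinuous D.subtype 1 fun u => by
    rw [one_mul]
    exact norm_coe_le hE u

theorem incl_apply (u : FormDomain hE) : incl hE u = ((show D from u : D) : L2 m) := rfl

theorem incl_injective : Function.Injective (incl hE) := Subtype.val_injective

theorem denseRange_adjoint_incl : DenseRange (incl hE).adjoint := by
  have h := (incl hE).orthogonal_ker
  rw [LinearMap.ker_eq_bot.2 (incl_injective hE), Submodule.bot_orthogonal_eq_top] at h
  exact (Submodule.dense_iff_topologicalClosure_eq_top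
    (s := ((incl hE).adjoint : L2 m →ₗ[ℝ] FormDomain hE).range)).2 h.symm

/-- The resolvent `(1 - L)⁻¹` of the operator `L` of a closed form, which by the Riesz
representation theorem is the composition of the adjoint of the inclusion with the inclusion. -/
noncomputable def resolvent : L2 m →L[ℝ] L2 m := (incl hE).comp (incl hE).adjoint

theorem inner_resolvent (x y : L2 m) :
    inner ℝ (resolvent hE x) y = inner ℝ ((incl hE).adjoint x) ((incl hE).adjoint y) :=
  (ContinuousLinearMap.adjoint_inner_right (incl hE) ((incl hE).adjoint x) y).symm

theorem eq_resolvent_iff (u f : L2 m) :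
    u = resolvent hE (u - f) ↔ GeneratorGraph E u f := by
  constructor
  · intro h
    set w : FormDomain hE := (incl hE).adjoint (u - f) with hw
    have hu : u = ((show D from w : D) : L2 m) := h
    refine ⟨hu ▸ (show D from w).2, fun v => ?_⟩
    have h1 : inner ℝ w (show FormDomain hE from v) = inner ℝ (u - f) (v : L2 m) :=
      ContinuousLinearMap.adjoint_inner_left _ _ _
    rw [inner_def, inner_sub_left] at h1
    have h2 : (⟨u, hu ▸ (show D from w).2⟩ : D) = (show D from w) := Subtype.ext hu
    rw [h2]
    change E (show D from w) v + inner ℝ ((show D from w : D) : L2 m) (v : L2 m) = _ at h1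
    rw [← hu] at h1
    linarith
  · rintro ⟨hu, h⟩
    have h1 : (show FormDomain hE from ⟨u, hu⟩) = (incl hE).adjoint (u - f) := by
      refine ext_inner_right ℝ fun v => ?_
      rw [ContinuousLinearMap.adjoint_inner_left, inner_def, inner_sub_left, incl_apply]
      change E ⟨u, hu⟩ (show D from v) + inner ℝ u _ = _
      rw [h]
      ring
    exact congrArg (incl hE) h1

theorem isResolvent (hD : Dense (D : Set (L2 m))) :
    HilbertSemigroup.IsResolvent (resolvent hE) where
  symm x y := by
    rw [inner_resolvent, real_inner_comm, ← inner_resolvent, real_inner_comm]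
  norm_sq_le x := by
    rw [inner_resolvent, real_inner_self_eq_norm_sq]
    exact pow_le_pow_left₀ (norm_nonneg _) (norm_coe_le hE _) 2
  inj x hx := by
    have h0 : (incl hE).adjoint x = 0 := incl_injective hE (by rw [map_zero]; exact hx)
    refine hD.eq_zero_of_inner_left (𝕜 := ℝ) fun v hv => ?_
    have h1 := ContinuousLinearMap.adjoint_inner_left (incl hE) (show FormDomain hE from ⟨v, hv⟩) x
    rw [h0, inner_zero_left] at h1
    exact h1.symm

end FormDomain

theorem IsClosedForm.exists_isSemigroupOf (hE : IsClosedForm E) (hD : Dense (D : Set (L2 m))) :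
    ∃ T : ℝ≥0 → L2 m →L[ℝ] L2 m, IsSemigroupOf E T := by
  obtain ⟨T, h0, hadd, hsymm, hcontr, hcont, hgen⟩ :=
    (FormDomain.isResolvent hE hD).exists_semigroup
  exact ⟨T, h0, hadd, hsymm, hcontr, hcont, fun u f =>
    (hgen u f).trans (FormDomain.eq_resolvent_iff hE u f)⟩

/-- The domain of the generator of a semigroup associated with a closed form is dense. -/
theorem IsClosedForm.dense_generator (hE : IsClosedForm E) (hD : Dense (D : Set (L2 m))) :
    Dense {u : L2 m | ∃ f : L2 m, GeneratorGraph E u f} := by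
  have hR := FormDomain.isResolvent hE hD
  refine (HilbertSemigroup.denseRange_of_symmetric_of_injective hR.symm hR.inj).mono ?_
  rintro _ ⟨x, rfl⟩
  refine ⟨FormDomain.resolvent hE x - x, (FormDomain.eq_resolvent_iff hE _ _).1 ?_⟩
  rw [sub_sub_cancel]

/-- A closed form is lower semicontinuous on its domain for `L²` convergence: a sequence that
converges in `L²` and is bounded in energy converges weakly for the inner product `E₁`, since the
vectors `(1 - L)⁻¹ h` are dense in `D`. -/
theorem IsClosedForm.le_of_tendsto (hE : IsClosedForm E) {u : ℕ → D} {w : D} {K : ℝ}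
    (hu : Tendsto (fun n => (u n : L2 m)) atTop (𝓝 (w : L2 m)))
    (hK : ∀ᶠ n in atTop, E (u n) (u n) ≤ K) :
    E w w ≤ K := by
  let w' : FormDomain hE := w
  have hlim : Tendsto (fun n => √(K + ‖(u n : L2 m)‖ ^ 2)) atTop (𝓝 √(K + ‖(w : L2 m)‖ ^ 2)) :=
    ((hu.norm.pow 2).const_add K).sqrt
  have hle : ∀ x : FormDomain hE, inner ℝ w' x ≤ √(K + ‖(w : L2 m)‖ ^ 2) * ‖x‖ := by
    intro x
    refine (FormDomain.denseRange_adjoint_incl hE).induction_on x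
      (isClosed_le (by fun_prop) (by fun_prop)) fun h => ?_
    rw [ContinuousLinearMap.adjoint_inner_right]
    refine le_of_tendsto_of_tendsto (hu.inner (tendsto_const_nhds (x := h)))
      (hlim.mul_const _) (hK.mono fun n hn => ?_)
    have h1 : inner ℝ (u n : L2 m) h =
        inner ℝ (show FormDomain hE from u n) ((FormDomain.incl hE).adjoint h) :=
      (ContinuousLinearMap.adjoint_inner_right (FormDomain.incl hE)
        (show FormDomain hE from u n) h).symm
    refine h1.trans_le <| (real_inner_le_norm _ _).trans
      (mul_le_mul_of_nonneg_right ?_ (norm_nonneg _))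
    refine Real.le_sqrt_of_sq_le ?_
    rw [FormDomain.norm_sq, energyOne]
    exact add_le_add hn le_rfl
  have h := hle w'
  rw [real_inner_self_eq_norm_sq, pow_two] at h
  obtain ⟨n, hn⟩ := hK.exists
  have hKnonneg : 0 ≤ K := (hE.nonneg _).trans hn
  have h2 : ‖w'‖ ≤ √(K + ‖(w : L2 m)‖ ^ 2) := by
    by_contra! hlt
    have hpos : 0 < ‖w'‖ := (Real.sqrt_nonneg _).trans_lt hlt
    nlinarith
  rw [Real.le_sqrt (norm_nonneg _) (by positivity), FormDomain.norm_sq] at h2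
  change E w w + ‖(w : L2 m)‖ ^ 2 ≤ _ at h2
  linarith

end DirichletForms

/-! ### Properties of the semigroup of a form -/

namespace DirichletForms

variable {X : Type*} [MeasurableSpace X] {m : Measure X} {D : Submodule ℝ (L2 m)}
  {E : LinearMap.BilinForm ℝ D}

theorem GeneratorGraph.sub {u f v g : L2 m} (hu : GeneratorGraph E u f)
    (hv : GeneratorGraph E v g) : GeneratorGraph E (u - v) (f - g) := by
  obtain ⟨hu, hu'⟩ := hu
  obtain ⟨hv, hv'⟩ := hv
  refine ⟨D.sub_mem hu hv, fun w => ?_⟩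
  have e : (⟨u - v, D.sub_mem hu hv⟩ : D) = ⟨u, hu⟩ - ⟨v, hv⟩ := rfl
  rw [e, map_sub, LinearMap.sub_apply, hu', hv', inner_sub_left]
  ring

theorem GeneratorGraph.inner_nonpos (hE : IsClosedForm E) {u f : L2 m}
    (hu : GeneratorGraph E u f) : inner ℝ f u ≤ 0 := by
  obtain ⟨hu, hu'⟩ := hu
  have h := hu' ⟨u, hu⟩
  have := hE.nonneg ⟨u, hu⟩
  dsimp only at h
  linarith

namespace IsSemigroupOf

variable {T : ℝ≥0 → L2 m →L[ℝ] L2 m}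

theorem generatorGraph_apply (hT : IsSemigroupOf E T) {u f : L2 m} (h : GeneratorGraph E u f)
    (s : ℝ≥0) : GeneratorGraph E (T s u) (T s f) := by
  refine (hT.generator _ _).1 ?_
  refine (((T s).continuous.tendsto f).comp ((hT.generator _ _).2 h)).congr fun t => ?_
  simp only [Function.comp_apply]
  rw [map_smul, map_sub, ← ContinuousLinearMap.comp_apply, ← hT.add, add_comm, hT.add,
    ContinuousLinearMap.comp_apply]

theorem continuous_orbit (hT : IsSemigroupOf E T) (u : L2 m) : Continuous fun t => T t u := by
  have h0 : Tendsto (fun t : ℝ≥0 => ‖T t u - u‖) (𝓝 0) (𝓝 0) := by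
    have hc : ContinuousWithinAt (fun t : ℝ≥0 => T t u) (Set.Ioi 0) 0 := by
      rw [ContinuousWithinAt, hT.zero]
      exact hT.continuous u
    rw [continuousWithinAt_Ioi_iff_Ici, ← bot_eq_zero (α := ℝ≥0), Set.Ici_bot,
      continuousWithinAt_univ, bot_eq_zero, ContinuousAt, hT.zero] at hc
    exact tendsto_iff_norm_sub_tendsto_zero.1 hc
  have hle : ∀ s r : ℝ≥0, ‖T (s + r) u - T s u‖ ≤ ‖T r u - u‖ := fun s r => by
    rw [hT.add, ContinuousLinearMap.comp_apply, ← map_sub]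
    exact hT.contraction _ _
  refine continuous_iff_continuousAt.2 fun t => tendsto_iff_norm_sub_tendsto_zero.2 ?_
  have hd : Tendsto (fun s : ℝ≥0 => nndist s t) (𝓝 t) (𝓝 0) := by
    have : Continuous fun s : ℝ≥0 => nndist s t := by fun_prop
    simpa using this.tendsto t
  refine squeeze_zero (fun _ => norm_nonneg _) (fun s => ?_) (h0.comp hd)
  rcases le_total s t with h | h
  · have e : t = s + nndist s t := by
      rw [NNReal.nndist_eq, tsub_eq_zero_of_le h, max_eq_right zero_le, add_tsub_cancel_of_le h]
    have := hle s (nndist s t)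
    rw [← e, norm_sub_rev] at this
    exact this
  · have e : s = t + nndist s t := by
      rw [NNReal.nndist_eq, tsub_eq_zero_of_le h, max_eq_left zero_le, add_tsub_cancel_of_le h]
    have := hle t (nndist s t)
    rw [← e] at this
    exact this

theorem hasDerivWithinAt_orbit (hT : IsSemigroupOf E T) {u f : L2 m} (h : GeneratorGraph E u f)
    {s : ℝ} (hs : 0 ≤ s) :
    HasDerivWithinAt (fun r : ℝ => T r.toNNReal u) (T s.toNNReal f) (Set.Ici s) s := by
  rw [← hasDerivWithinAt_Ioi_iff_Ici, hasDerivWithinAt_iff_tendsto_slope' Set.self_notMem_Ioi]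
  have hg := ((T s.toNNReal).continuous.tendsto f).comp ((hT.generator _ _).2 h)
  have hshift : Tendsto (fun r : ℝ => (r - s).toNNReal) (𝓝[>] s) (𝓝[>] 0) := by
    refine tendsto_nhdsWithin_of_tendsto_nhds_of_eventually_within _ ?_
      (eventually_nhdsWithin_of_forall fun r hr => Real.toNNReal_pos.2 (sub_pos.2 hr))
    have hc : Continuous fun r : ℝ => (r - s).toNNReal := by fun_prop
    have := hc.tendsto s
    rw [sub_self, Real.toNNReal_zero] at this
    exact this.mono_left nhdsWithin_le_nhds
  refine (hg.comp hshift).congr' (eventually_nhdsWithin_of_forall fun r hr => ?_)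
  have hr' : 0 ≤ r - s := (sub_pos.2 hr).le
  simp only [Function.comp_apply, slope_def_module]
  rw [Real.coe_toNNReal _ hr', map_smul, map_sub, ← ContinuousLinearMap.comp_apply, ← hT.add,
    ← Real.toNNReal_add hs hr', add_sub_cancel]

theorem apply_eq_self (hT : IsSemigroupOf E T) {u : L2 m} (h : GeneratorGraph E u 0) (t : ℝ≥0) :
    T t u = u := by
  have hc : ContinuousOn (fun r : ℝ => T r.toNNReal u) (Set.Icc 0 t) :=
    ((hT.continuous_orbit u).comp continuous_real_toNNReal).continuousOn
  have := constant_of_has_deriv_right_zero hc (fun s hs => by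
    simpa using hT.hasDerivWithinAt_orbit h hs.1) t ⟨t.2, le_rfl⟩
  simpa [hT.zero] using this

/-- A bounded operator `Q` that commutes with the generator commutes with the semigroup: the
squared norm of `T_t Q u - Q T_t u`, which vanishes at `t = 0`, has non-positive derivative. -/
theorem apply_comm (hT : IsSemigroupOf E T) (hE : IsClosedForm E) (hD : Dense (D : Set (L2 m)))
    {Q : L2 m →L[ℝ] L2 m} (hQ : ∀ u f, GeneratorGraph E u f → GeneratorGraph E (Q u) (Q f))
    (t : ℝ≥0) (u : L2 m) : T t (Q u) = Q (T t u) := by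
  refine congrFun (Continuous.ext_on (hE.dense_generator hD) (f := fun u => T t (Q u))
    (g := fun u => Q (T t u)) (by fun_prop) (by fun_prop) ?_) u
  rintro u ⟨f, hf⟩
  have hcont : ∀ v, Continuous fun r : ℝ => T r.toNNReal v := fun v =>
    (hT.continuous_orbit v).comp continuous_real_toNNReal
  have hle := image_le_of_deriv_right_le_deriv_boundary (a := 0) (b := t)
    (f := fun r : ℝ => ‖T r.toNNReal (Q u) - Q (T r.toNNReal u)‖ ^ 2)
    (f' := fun r => 2 * inner ℝ (T r.toNNReal (Q u) - Q (T r.toNNReal u))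
      (T r.toNNReal (Q f) - Q (T r.toNNReal f)))
    (B := fun _ => 0) (B' := fun _ => 0)
    ((((hcont (Q u)).sub (Q.continuous.comp (hcont u))).norm.pow 2).continuousOn)
    (fun s hs => ((hT.hasDerivWithinAt_orbit (hQ u f hf) hs.1).sub
      (Q.hasFDerivAt.comp_hasDerivWithinAt s (hT.hasDerivWithinAt_orbit hf hs.1))).norm_sq)
    (by simp [hT.zero]) continuousOn_const (fun _ _ => hasDerivWithinAt_const _ _ _)
    (fun s hs => by
      have h := ((hT.generatorGraph_apply (hQ u f hf) s.toNNReal).sub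
        (hQ _ _ (hT.generatorGraph_apply hf s.toNNReal))).inner_nonpos hE
      rw [real_inner_comm] at h
      linarith)
  have h := hle (x := (t : ℝ)) ⟨t.2, le_rfl⟩
  rw [Real.toNNReal_coe] at h
  exact sub_eq_zero.1 (norm_eq_zero.1 (pow_eq_zero_iff two_ne_zero |>.1 (h.antisymm (sq_nonneg _))))

end IsSemigroupOf

end DirichletForms

/-! ### Contractions and locality for continuous functions -/

namespace DirichletForms

section Form

variable {X : Type*} [MeasurableSpace X] {m : Measure X} {D : Submodule ℝ (L2 m)}
  {E : LinearMap.BilinForm ℝ D}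

theorem IsClosedForm.energyOne_nonneg (hE : IsClosedForm E) (u : D) : 0 ≤ energyOne E u :=
  add_nonneg (hE.nonneg u) (sq_nonneg _)

theorem IsClosedForm.energy_add_of_null (hE : IsClosedForm E) {z : D} (hz : ∀ v, E z v = 0)
    (u : D) : E (u + z) (u + z) = E u u := by
  simp [hz, hE.symm u z]

theorem energy_smul (c : ℝ) (u : D) : E (c • u) (c • u) = c ^ 2 * E u u := by
  simp only [map_smul, LinearMap.smul_apply, smul_eq_mul]
  ring

/-- Convergence for the norm `E₁^{1/2}` implies convergence in `L²` and of the energies. -/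
theorem IsClosedForm.tendsto_of_energyOne (hE : IsClosedForm E) {u : D} {w : ℕ → D}
    (h : Tendsto (fun n => energyOne E (u - w n)) atTop (𝓝 0)) :
    Tendsto (fun n => (w n : L2 m)) atTop (𝓝 (u : L2 m)) ∧
      Tendsto (fun n => E (w n) (w n)) atTop (𝓝 (E u u)) ∧
      CauchySeq (fun n => (show FormDomain hE from w n)) := by
  have h1 : Tendsto (fun n => (show FormDomain hE from w n)) atTop
      (𝓝 (show FormDomain hE from u)) := by
    rw [tendsto_iff_norm_sub_tendsto_zero]
    have h2 : Tendsto (fun n =>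
        ‖(show FormDomain hE from u) - (show FormDomain hE from w n)‖ ^ 2) atTop (𝓝 0) := by
      simp only [FormDomain.norm_sq]
      exact h
    have h3 := h2.sqrt
    simp only [Real.sqrt_sq (norm_nonneg _), Real.sqrt_zero] at h3
    exact h3.congr fun n => norm_sub_rev _ _
  have h2 : Tendsto (fun n => (w n : L2 m)) atTop (𝓝 (u : L2 m)) :=
    ((FormDomain.incl hE).continuous.tendsto _).comp h1
  refine ⟨h2, ?_, h1.cauchySeq⟩
  have h3 := (h1.norm.pow 2).sub (h2.norm.pow 2)
  have e : ∀ v : D, E v v = ‖(show FormDomain hE from v)‖ ^ 2 - ‖(v : L2 m)‖ ^ 2 := fun v => by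
    rw [FormDomain.norm_sq]
    exact (add_sub_cancel_right _ _).symm
  simp only [e]
  exact h3

end Form

section Finite

variable {X : Type*} [MeasurableSpace X] {m : Measure X} [IsFiniteMeasure m]
  {D : Submodule ℝ (L2 m)} {E : LinearMap.BilinForm ℝ D}

/-- The generator of a conservative form annihilates the constants. -/
theorem IsConservative.generatorGraph_const (h : IsConservative E) :
    GeneratorGraph E (Lp.const 2 m (1 : ℝ)) 0 := by
  obtain ⟨T, hT, h1⟩ := h
  refine (hT.generator _ _).1 (tendsto_const_nhds.congr' ?_)
  filter_upwards [self_mem_nhdsWithin] with t ht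
  rw [h1 t ht, sub_self, smul_zero]

/-- The contractions `r ↦ (a ∨ r) ∧ (a + M)` operate on a conservative Dirichlet form. -/
theorem IsDirichletForm.clamp_mem (hE : IsDirichletForm E)
    (h1 : GeneratorGraph E (Lp.const 2 m (1 : ℝ)) 0) {a M : ℝ} (hM : 0 < M) (u : D) {v : L2 m}
    (hv : ∀ᵐ x ∂m, v x = min (max a ((u : L2 m) x)) (a + M)) :
    ∃ hv : v ∈ D, E ⟨v, hv⟩ ⟨v, hv⟩ ≤ E u u := by
  obtain ⟨h1D, h1E⟩ := h1
  set one : D := ⟨Lp.const 2 m (1 : ℝ), h1D⟩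
  have hnull : ∀ c : ℝ, ∀ w, E (c • one) w = 0 := fun c w => by
    rw [map_smul, LinearMap.smul_apply, h1E, inner_zero_left, neg_zero, smul_zero]
  obtain ⟨w, hw, hwE⟩ := hE.markov (M⁻¹ • (u + (-a) • one))
  have hvw : v = ((M • w + a • one : D) : L2 m) := by
    refine Lp.ext ?_
    have e1 := Lp.coeFn_add (M • (w : L2 m)) (a • (Lp.const 2 m (1 : ℝ)))
    have e2 := Lp.coeFn_smul M (w : L2 m)
    have e3 := Lp.coeFn_smul a (Lp.const 2 m (1 : ℝ))
    have e4 := Lp.coeFn_const (p := 2) (μ := m) (c := (1 : ℝ))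
    have e5 := Lp.coeFn_smul M⁻¹ ((u : L2 m) + (-a) • (Lp.const 2 m (1 : ℝ)))
    have e6 := Lp.coeFn_add (u : L2 m) ((-a) • (Lp.const 2 m (1 : ℝ)))
    have e7 := Lp.coeFn_smul (-a) (Lp.const 2 m (1 : ℝ))
    filter_upwards [hv, hw, e1, e2, e3, e4, e5, e6, e7] with x hv hw e1 e2 e3 e4 e5 e6 e7
    change _ = ((M • (w : L2 m) + a • (Lp.const 2 m (1 : ℝ)) : L2 m)) x
    change (w : L2 m) x =
      min (max 0 ((M⁻¹ • ((u : L2 m) + (-a) • (Lp.const 2 m (1 : ℝ))) : L2 m) x)) 1 at hw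
    rw [e5, Pi.smul_apply, e6, Pi.add_apply, e7, Pi.smul_apply, e4] at hw
    rw [e1, Pi.add_apply, e2, e3, Pi.smul_apply, Pi.smul_apply, e4, hv, hw]
    simp only [Function.const_apply, smul_eq_mul, mul_one]
    rw [mul_min_of_nonneg _ _ hM.le, mul_max_of_nonneg _ _ hM.le, mul_inv_cancel_left₀ hM.ne',
      ← min_add_add_right, ← max_add_add_right]
    rw [mul_zero, zero_add, neg_add_cancel_right, mul_one, add_comm M a]
  refine ⟨hvw ▸ (M • w + a • one : D).2, ?_⟩
  have e : (⟨v, hvw ▸ (M • w + a • one : D).2⟩ : D) = M • w + a • one := Subtype.ext hvw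
  rw [e, hE.isClosedForm.energy_add_of_null (hnull a), energy_smul]
  rw [energy_smul, hE.isClosedForm.energy_add_of_null (hnull (-a))] at hwE
  calc M ^ 2 * E w w ≤ M ^ 2 * (M⁻¹ ^ 2 * E u u) := by gcongr
    _ = E u u := by field_simp

end Finite

section Continuous

variable {X : Type*} [TopologicalSpace X] [CompactSpace X] [MeasurableSpace X] [BorelSpace X]
  {m : Measure X} [IsFiniteMeasure m] {D : Submodule ℝ (L2 m)} {E : LinearMap.BilinForm ℝ D}

/-- The class in `L²(X, m)` of a continuous function. -/
noncomputable abbrev toL2 (m : Measure X) [IsFiniteMeasure m] (f : C(X, ℝ)) : L2 m :=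
  ContinuousMap.toLp (E := ℝ) 2 m ℝ f

theorem toL2_coeFn (f : C(X, ℝ)) : toL2 m f =ᵐ[m] f := ContinuousMap.coeFn_toLp _ _

theorem toL2_const (a : ℝ) :
    toL2 m (ContinuousMap.const X a) = a • Lp.const 2 m (1 : ℝ) := by
  refine Lp.ext ?_
  filter_upwards [toL2_coeFn (m := m) (ContinuousMap.const X a),
    Lp.coeFn_smul a (Lp.const 2 m (1 : ℝ)), Lp.coeFn_const (p := 2) (μ := m) (c := (1 : ℝ))]
    with x h1 h2 h3
  rw [h1, h2, Pi.smul_apply, h3]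
  simp

theorem essSupport_toL2_subset {f : C(X, ℝ)} {Z : Set X} (hZ : IsClosed Z)
    (h : ∀ x, x ∉ Z → f x = 0) : essSupport (toL2 m f) ⊆ Z := by
  refine Measure.support_subset_of_isClosed hZ ?_
  rw [mem_ae_iff, withDensity_apply _ hZ.measurableSet.compl,
    lintegral_eq_zero_iff' (by fun_prop)]
  filter_upwards [ae_restrict_of_ae (toL2_coeFn (m := m) f),
    ae_restrict_mem hZ.measurableSet.compl] with x h1 h2
  change ‖toL2 m f x‖ₑ = 0
  rw [h1, h x h2, enorm_zero]

/-- The function `(a ∨ f) ∧ (a + M)`. -/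
def clamp (a M : ℝ) (f : C(X, ℝ)) : C(X, ℝ) :=
  ⟨fun x => min (max a (f x)) (a + M), by fun_prop⟩

theorem IsDirichletForm.toL2_clamp_mem (hE : IsDirichletForm E)
    (h1 : GeneratorGraph E (Lp.const 2 m (1 : ℝ)) 0) {a M : ℝ} (hM : 0 < M) {u : D} {f : C(X, ℝ)}
    (hu : (u : L2 m) = toL2 m f) :
    ∃ v : D, (v : L2 m) = toL2 m (clamp a M f) ∧ E v v ≤ E u u := by
  obtain ⟨hv, hle⟩ := hE.clamp_mem h1 (a := a) hM u (v := toL2 m (clamp a M f)) (by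
    filter_upwards [toL2_coeFn (m := m) (clamp a M f), toL2_coeFn (m := m) f] with x h1 h2
    rw [h1, hu, h2]
    rfl)
  exact ⟨⟨_, hv⟩, rfl, hle⟩

/-- Locality in the sense of disjoint supports improves to pointwise disjointness for continuous
functions: the support of `(g - ε)⁺` is disjoint from the support of `h`, so that
`E((g - ε)⁺ ± h) ≤ E(g) + E(h)`, and lower semicontinuity gives `±E(g, h) ≤ 0` as `ε → 0`. -/
theorem energy_eq_zero_of_mul_eq_zero (hE : IsDirichletForm E)
    (h1 : GeneratorGraph E (Lp.const 2 m (1 : ℝ)) 0) (hloc : IsLocal E) {u v : D}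
    {g h : C(X, ℝ)} (hu : (u : L2 m) = toL2 m g) (hv : (v : L2 m) = toL2 m h)
    (hg : ∀ x, 0 ≤ g x) (hgh : ∀ x, g x = 0 ∨ h x = 0) : E u v = 0 := by
  obtain ⟨M, hM, hgM⟩ : ∃ M : ℝ, 0 < M ∧ ∀ x, g x ≤ M :=
    ⟨‖g‖ + 1, by positivity, fun x =>
      (le_abs_self _).trans ((g.norm_coe_le_norm x).trans (by linarith))⟩
  set one : D := ⟨_, h1.1⟩
  have hnull : ∀ c : ℝ, ∀ w, E (c • one) w = 0 := fun c w => by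
    rw [map_smul, LinearMap.smul_apply, h1.2, inner_zero_left, neg_zero, smul_zero]
  -- `w n` is the class of `(g - ε)⁺` with `ε = 1 / (n + 1)`.
  have hex : ∀ n : ℕ, ∃ w : D, (w : L2 m) = toL2 m (clamp ((1 : ℝ) / (n + 1)) M g -
      ContinuousMap.const X ((1 : ℝ) / (n + 1))) ∧ E w w ≤ E u u := fun n => by
    obtain ⟨w, hw, hwE⟩ := hE.toL2_clamp_mem h1 (a := (1 : ℝ) / (n + 1)) hM hu
    refine ⟨w + (-((1 : ℝ) / (n + 1))) • one, ?_, ?_⟩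
    · rw [toL2, map_sub, ← toL2, ← toL2, toL2_const, ← hw, neg_smul, ← sub_eq_add_neg]
      rfl
    · rwa [hE.isClosedForm.energy_add_of_null (hnull _)]
  choose w hw hwE using hex
  have hwv : ∀ n, E (w n) v = 0 := fun n => by
    have hpos : 0 < (1 : ℝ) / (n + 1) := by positivity
    have hZ1 : IsClosed {x | (1 : ℝ) / (n + 1) ≤ g x} := isClosed_le (by fun_prop) (by fun_prop)
    have hZ2 : IsClosed {x | g x = 0} := isClosed_eq (by fun_prop) (by fun_prop)
    have hs1 : essSupport (w n : L2 m) ⊆ {x | (1 : ℝ) / (n + 1) ≤ g x} := by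
      rw [hw]
      refine essSupport_toL2_subset hZ1 fun x hx => ?_
      simp only [Set.mem_ofPred_eq, not_le] at hx
      change min (max ((1 : ℝ) / (n + 1)) (g x)) ((1 : ℝ) / (n + 1) + M) - (1 : ℝ) / (n + 1) = 0
      rw [max_eq_left hx.le, min_eq_left (by linarith), sub_self]
    have hs2 : essSupport (v : L2 m) ⊆ {x | g x = 0} := by
      rw [hv]
      exact essSupport_toL2_subset hZ2 fun x hx => (hgh x).resolve_left hx
    refine hloc _ _ Measure.isClosed_support.isCompact Measure.isClosed_support.isCompact ?_
    refine Disjoint.mono hs1 hs2 (Set.disjoint_left.2 fun x hx hx' => ?_)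
    simp only [Set.mem_ofPred_eq] at hx hx'
    linarith
  have hlim : Tendsto (fun n => (w n : L2 m)) atTop (𝓝 (u : L2 m)) := by
    simp only [hw]
    rw [hu]
    refine ((ContinuousMap.toLp (E := ℝ) 2 m ℝ).continuous.tendsto g).comp ?_
    rw [tendsto_iff_norm_sub_tendsto_zero]
    refine squeeze_zero (fun _ => norm_nonneg _) (fun n => ?_)
      tendsto_one_div_add_atTop_nhds_zero_nat
    refine (ContinuousMap.norm_le _ (by positivity)).2 fun x => ?_
    have hpos : 0 < (1 : ℝ) / (n + 1) := by positivity
    change |min (max ((1 : ℝ) / (n + 1)) (g x)) ((1 : ℝ) / (n + 1) + M) - (1 : ℝ) / (n + 1) - g x| ≤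
      (1 : ℝ) / (n + 1)
    rw [min_eq_left (max_le (by linarith) (by linarith [hgM x])), abs_le]
    rcases le_total ((1 : ℝ) / (n + 1)) (g x) with h | h
    · rw [max_eq_right h]
      constructor <;> linarith
    · rw [max_eq_left h]
      constructor <;> linarith [hg x]
  have hquad : ∀ s : ℝ, s * E u v * 2 ≤ 0 := fun s => by
    have hle := hE.isClosedForm.le_of_tendsto (u := fun n => w n + s • v) (w := u + s • v)
      (K := E u u + s ^ 2 * E v v) (hlim.add tendsto_const_nhds)
      (Eventually.of_forall fun n => by
        simp only [map_add, LinearMap.add_apply, map_smul, LinearMap.smul_apply, smul_eq_mul, hwv,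
          hE.symm v (w n)]
        nlinarith [hwE n])
    simp only [map_add, LinearMap.add_apply, map_smul, LinearMap.smul_apply, smul_eq_mul,
      hE.symm v u] at hle
    nlinarith
  linarith [hquad 1, hquad (-1)]

/-- For continuous `f` and a local conservative form, the truncation `(0 ∨ f) ∧ 1` is orthogonal
to the remainder `f - (0 ∨ f) ∧ 1 = (f - 1)⁺ + (f ∧ 0)`. -/
theorem energy_clamp_sub_eq_zero (hE : IsDirichletForm E)
    (h1 : GeneratorGraph E (Lp.const 2 m (1 : ℝ)) 0) (hloc : IsLocal E) {u v : D}
    {f : C(X, ℝ)} (hu : (u : L2 m) = toL2 m f) (hv : (v : L2 m) = toL2 m (clamp 0 1 f)) :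
    E v (u - v) = 0 := by
  obtain ⟨N, hN, hfN⟩ : ∃ N : ℝ, 1 < N ∧ ∀ x, |f x| ≤ N :=
    ⟨‖f‖ + 2, by linarith [norm_nonneg f], fun x =>
      (f.norm_coe_le_norm x).trans (by linarith)⟩
  set one : D := ⟨_, h1.1⟩
  have hnull : ∀ w, E one w = 0 := fun w => by
    rw [h1.2, inner_zero_left, neg_zero]
  have hone' : (one : L2 m) = toL2 m (ContinuousMap.const X 1) := by
    rw [toL2_const, one_smul]
  obtain ⟨a, ha, -⟩ := hE.toL2_clamp_mem h1 (a := 1) (M := N) (by linarith) hu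
  obtain ⟨b, hb, -⟩ := hE.toL2_clamp_mem h1 (a := -N) (M := N) (by linarith) hu
  have hsum : u - v = (a - one) + b := by
    refine Subtype.ext ?_
    change (u : L2 m) - v = (a - one) + b
    rw [hu, hv, ha, hb, hone']
    simp only [toL2, ← map_sub, ← map_add]
    congr 1
    ext x
    change f x - min (max 0 (f x)) (0 + 1) =
      min (max 1 (f x)) (1 + N) - 1 + min (max (-N) (f x)) (-N + N)
    have := abs_le.1 (hfN x)
    rcases le_total (f x) 0 with h | h
    · rw [max_eq_left h, max_eq_left (by linarith), max_eq_right (by linarith),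
        min_eq_left (by linarith), min_eq_left (by linarith), min_eq_left (by linarith)]
      ring
    · rw [max_eq_right h, max_eq_right (a := -N) (by linarith), neg_add_cancel,
        min_eq_right (b := (0 : ℝ)) h]
      rcases le_total (f x) 1 with h' | h'
      · rw [max_eq_left h', min_eq_left (by linarith), min_eq_left (by linarith)]
        ring
      · rw [max_eq_right h', min_eq_right (by linarith), min_eq_left (by linarith)]
        ring
  have hvb : E v b = 0 := by
    refine energy_eq_zero_of_mul_eq_zero hE h1 hloc hv hb (fun x => ?_) fun x => ?_
    · exact le_min (le_max_left _ _) (by norm_num)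
    · change min (max 0 (f x)) (0 + 1) = 0 ∨ min (max (-N) (f x)) (-N + N) = 0
      rcases le_total (f x) 0 with h | h
      · left
        rw [max_eq_left h, min_eq_left (by norm_num)]
      · right
        rw [neg_add_cancel]
        exact min_eq_right (h.trans (le_max_right _ _))
  have hva : E (one - v) (a - one) = 0 := by
    refine energy_eq_zero_of_mul_eq_zero hE h1 hloc
      (g := ContinuousMap.const X 1 - clamp 0 1 f)
      (h := clamp 1 N f - ContinuousMap.const X 1) ?_ ?_ (fun x => ?_) fun x => ?_
    · change (one : L2 m) - v = _
      rw [hone', hv, toL2, toL2, ← map_sub]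
    · change (a : L2 m) - one = _
      rw [hone', ha, toL2, toL2, ← map_sub]
    · change 0 ≤ 1 - min (max 0 (f x)) (0 + 1)
      linarith [min_le_right (max 0 (f x)) (0 + 1)]
    · change 1 - min (max 0 (f x)) (0 + 1) = 0 ∨ min (max 1 (f x)) (1 + N) - 1 = 0
      rcases le_total (f x) 1 with h | h
      · right
        rw [max_eq_left h, min_eq_left (by linarith), sub_self]
      · left
        rw [max_eq_right (by linarith), min_eq_right (by linarith)]
        ring
  rw [map_sub E, LinearMap.sub_apply, hnull, zero_sub, neg_eq_zero] at hva
  rw [hsum, map_add, hva, hvb, add_zero]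

end Continuous

end DirichletForms

/-! ### Multiplication by an indicator and invariant sets -/

namespace DirichletForms

section Restrict

variable {X : Type*} [MeasurableSpace X] {m : Measure X} {A : Set X}

theorem coeFn_restrict (hA : MeasurableSet A) (u : L2 m) :
    restrict hA u =ᵐ[m] A.indicator u := MemLp.coeFn_toLp _

theorem norm_restrict_le (hA : MeasurableSet A) (u : L2 m) : ‖restrict hA u‖ ≤ ‖u‖ := by
  refine Lp.norm_le_norm_of_ae_le ?_
  filter_upwards [coeFn_restrict hA u] with x hx
  rw [hx]
  exact norm_indicator_le_norm_self _ _

/-- Multiplication by `1_A`, as a bounded operator on `L²`. -/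
noncomputable def restrictL (hA : MeasurableSet A) : L2 m →L[ℝ] L2 m :=
  LinearMap.mkContinuous
    { toFun := restrict hA
      map_add' := fun u v => Lp.ext (by
        filter_upwards [coeFn_restrict hA (u + v), coeFn_restrict hA u, coeFn_restrict hA v,
          Lp.coeFn_add u v, Lp.coeFn_add (restrict hA u) (restrict hA v)] with x h1 h2 h3 h4 h5
        rw [h1, h5, Pi.add_apply, h2, h3]
        by_cases hx : x ∈ A
        · simp only [Set.indicator_of_mem hx, h4, Pi.add_apply]
        · simp only [Set.indicator_of_notMem hx, add_zero])
      map_smul' := fun c u => Lp.ext (by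
        filter_upwards [coeFn_restrict hA (c • u), coeFn_restrict hA u,
          Lp.coeFn_smul c u, Lp.coeFn_smul c (restrict hA u)] with x h1 h2 h3 h4
        rw [RingHom.id_apply, h1, h4, Pi.smul_apply, h2]
        by_cases hx : x ∈ A
        · simp only [Set.indicator_of_mem hx, h3, Pi.smul_apply]
        · simp only [Set.indicator_of_notMem hx, smul_zero]) } 1
    fun u => by rw [one_mul]; exact norm_restrict_le hA u

theorem coeFn_restrictL (hA : MeasurableSet A) (u : L2 m) :
    restrictL hA u =ᵐ[m] A.indicator u := coeFn_restrict hA u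

theorem restrictL_restrictL (hA : MeasurableSet A) (u : L2 m) :
    restrictL hA (restrictL hA u) = restrictL hA u := by
  refine Lp.ext ?_
  filter_upwards [coeFn_restrictL hA (restrictL hA u), coeFn_restrictL hA u] with x h1 h2
  rw [h1, h2]
  by_cases hx : x ∈ A <;> simp [hx, h2]

theorem inner_restrictL (hA : MeasurableSet A) (u v : L2 m) :
    inner ℝ (restrictL hA u) v = inner ℝ u (restrictL hA v) := by
  rw [L2.inner_def, L2.inner_def]
  refine integral_congr_ae ?_
  filter_upwards [coeFn_restrictL hA u, coeFn_restrictL hA v] with x h1 h2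
  rw [h1, h2]
  by_cases hx : x ∈ A <;> simp [hx]

end Restrict

section Invariance

variable {X : Type*} [TopologicalSpace X] [CompactSpace X] [MeasurableSpace X] [BorelSpace X]
  {m : Measure X} [IsFiniteMeasure m] {D : Submodule ℝ (L2 m)} {E : LinearMap.BilinForm ℝ D}
  {A : Set X} {hA : MeasurableSet A}

theorem IsRegular.exists_seq (hreg : IsRegular E) (u : D) : ∃ (w : ℕ → D) (f : ℕ → C(X, ℝ)),
    (∀ n, (w n : L2 m) = toL2 m (f n)) ∧ ∀ n : ℕ, energyOne E (u - w n) < 1 / ((n : ℝ) + 1) := by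
  obtain ⟨C, hC⟩ := hreg
  choose w hw hE using fun n : ℕ => hC.dense_domain u (1 / ((n : ℝ) + 1)) (by positivity)
  choose f _ hf using hw
  exact ⟨w, f, fun n => (hf n).symm, hE⟩

/-- If the indicator of `A` has no energy, then multiplication by `1_A` does not increase the
energy of a continuous function: for `|f| ≤ M`, the function `1_A f + M (1 + 1_A)` is the
contraction `(M ∨ r) ∧ 3M` of `r = f + 2M 1_A`. -/
theorem IsDirichletForm.restrictL_mem_of_continuous (hE : IsDirichletForm E)
    (h1 : GeneratorGraph E (Lp.const 2 m (1 : ℝ)) 0)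
    (hz : GeneratorGraph E (restrictL hA (Lp.const 2 m (1 : ℝ))) 0) {u : D} {f : C(X, ℝ)}
    (hu : (u : L2 m) = toL2 m f) :
    ∃ v : D, (v : L2 m) = restrictL hA u ∧ E v v ≤ E u u := by
  obtain ⟨M, hM, hfM⟩ : ∃ M : ℝ, 0 < M ∧ ∀ x, |f x| ≤ M :=
    ⟨‖f‖ + 1, by positivity, fun x => (f.norm_coe_le_norm x).trans (by linarith)⟩
  set one : D := ⟨_, h1.1⟩
  set z : D := ⟨_, hz.1⟩
  have hnull : ∀ c d : ℝ, ∀ w, E (c • one + d • z) w = 0 := fun c d w => by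
    rw [map_add, map_smul, map_smul, LinearMap.add_apply, LinearMap.smul_apply,
      LinearMap.smul_apply, h1.2, hz.2]
    simp
  obtain ⟨hv, hvE⟩ := hE.clamp_mem h1 (a := M) (M := 2 * M) (by linarith)
    (u + ((0 : ℝ) • one + (2 * M) • z))
    (v := restrictL hA (u : L2 m) + (M • Lp.const 2 m (1 : ℝ) +
      M • restrictL hA (Lp.const 2 m (1 : ℝ)))) (by
    have e1 := Lp.coeFn_add (restrictL hA (u : L2 m)) (M • Lp.const 2 m (1 : ℝ) +
      M • restrictL hA (Lp.const 2 m (1 : ℝ)))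
    have e2 := Lp.coeFn_add (M • Lp.const 2 m (1 : ℝ)) (M • restrictL hA (Lp.const 2 m (1 : ℝ)))
    have e3 := Lp.coeFn_smul M (Lp.const 2 m (1 : ℝ))
    have e4 := Lp.coeFn_smul M (restrictL hA (Lp.const 2 m (1 : ℝ)))
    have e5 := Lp.coeFn_const (p := 2) (μ := m) (c := (1 : ℝ))
    have e6 := coeFn_restrictL hA (Lp.const 2 m (1 : ℝ))
    have e7 := coeFn_restrictL hA (u : L2 m)
    have e8 := Lp.coeFn_add (u : L2 m) ((2 * M) • restrictL hA (Lp.const 2 m (1 : ℝ)))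
    have e9 := Lp.coeFn_smul (2 * M) (restrictL hA (Lp.const 2 m (1 : ℝ)))
    have e10 := toL2_coeFn (m := m) f
    have e : ((u + ((0 : ℝ) • one + (2 * M) • z) : D) : L2 m) =
        (u : L2 m) + (2 * M) • restrictL hA (Lp.const 2 m (1 : ℝ)) := by
      rw [zero_smul, zero_add]
      rfl
    rw [e]
    filter_upwards [e1, e2, e3, e4, e5, e6, e7, e8, e9, e10]
      with x e1 e2 e3 e4 e5 e6 e7 e8 e9 e10
    rw [← hu] at e10
    have := abs_le.1 (hfM x)
    rw [e1, Pi.add_apply, e2, Pi.add_apply, e3, e4, Pi.smul_apply, Pi.smul_apply, e8, Pi.add_apply,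
      e9, Pi.smul_apply, e6, e7]
    by_cases hx : x ∈ A
    · simp only [Set.indicator_of_mem hx, e5, e10, Function.const_apply, smul_eq_mul, mul_one]
      rw [max_eq_right (by linarith), min_eq_left (by linarith)]
      ring
    · simp only [Set.indicator_of_notMem hx, e5, e10, Function.const_apply, smul_eq_mul, mul_one,
        mul_zero, add_zero, zero_add]
      rw [max_eq_left (by linarith), min_eq_left (by linarith)])
  have hmem : restrictL hA (u : L2 m) ∈ D := by
    have := D.sub_mem hv (M • one + M • z).2
    rwa [Submodule.coe_add, Submodule.coe_smul, Submodule.coe_smul, add_sub_cancel_right] at this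
  refine ⟨⟨_, hmem⟩, rfl, ?_⟩
  rw [hE.isClosedForm.energy_add_of_null (hnull _ _)] at hvE
  have e : (⟨_, hv⟩ : D) = ⟨restrictL hA (u : L2 m), hmem⟩ + (M • one + M • z) := rfl
  rwa [e, hE.isClosedForm.energy_add_of_null (hnull _ _)] at hvE

theorem IsDirichletForm.restrictL_mem (hE : IsDirichletForm E) (hreg : IsRegular E)
    (h1 : GeneratorGraph E (Lp.const 2 m (1 : ℝ)) 0)
    (hz : GeneratorGraph E (restrictL hA (Lp.const 2 m (1 : ℝ))) 0) (u : D) :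
    ∃ v : D, (v : L2 m) = restrictL hA u ∧ E v v ≤ E u u := by
  have hEc := hE.isClosedForm
  obtain ⟨w, f, hwf, hw⟩ := hreg.exists_seq u
  have hlim : Tendsto (fun n => energyOne E (u - w n)) atTop (𝓝 0) :=
    squeeze_zero (fun n => hEc.energyOne_nonneg _) (fun n => (hw n).le)
      tendsto_one_div_add_atTop_nhds_zero_nat
  obtain ⟨hL2, hen, hcau⟩ := hEc.tendsto_of_energyOne hlim
  choose p hp hpE using fun n => hE.restrictL_mem_of_continuous h1 hz (hwf n)
  have hcontr : ∀ i j, energyOne E (p i - p j) ≤ energyOne E (w i - w j) := fun i j => by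
    obtain ⟨q, hq, hqE⟩ := hE.restrictL_mem_of_continuous h1 hz (u := w i - w j)
      (f := f i - f j) (by
      rw [toL2, map_sub, ← toL2, ← toL2, ← hwf, ← hwf]
      rfl)
    have e : p i - p j = q := Subtype.ext (by
      rw [hq, Submodule.coe_sub, Submodule.coe_sub, map_sub, hp, hp])
    rw [e]
    refine add_le_add hqE (pow_le_pow_left₀ (norm_nonneg _) ?_ 2)
    rw [hq]
    exact norm_restrict_le hA _
  obtain ⟨v, hv⟩ := hE.closed p fun ε hε => by
    obtain ⟨N, hN⟩ := Metric.cauchySeq_iff.1 hcau (√ε) (Real.sqrt_pos.2 hε)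
    refine ⟨N, fun i hi j hj => (hcontr i j).trans_lt ?_⟩
    have h := hN i hi j hj
    rw [dist_eq_norm, Real.lt_sqrt (norm_nonneg _), FormDomain.norm_sq] at h
    exact h
  obtain ⟨hpL2, hpen, -⟩ := hEc.tendsto_of_energyOne (u := v) (w := p) (hv.congr fun n => by
    rw [energyOne, energyOne, ← neg_sub v (p n), Submodule.coe_neg, norm_neg]
    simp only [map_neg, LinearMap.neg_apply, neg_neg])
  refine ⟨v, tendsto_nhds_unique hpL2 ?_, le_of_tendsto_of_tendsto' hpen hen hpE⟩
  simp only [hp]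
  exact ((restrictL hA).continuous.tendsto _).comp hL2

/-- If the indicator of `A` has no energy, then `A` is invariant for the semigroup. -/
theorem isInvariantSet_of_generatorGraph (hE : IsDirichletForm E) (hreg : IsRegular E)
    (h1 : GeneratorGraph E (Lp.const 2 m (1 : ℝ)) 0)
    (hz : GeneratorGraph E (restrictL hA (Lp.const 2 m (1 : ℝ))) 0)
    {T : ℝ≥0 → L2 m →L[ℝ] L2 m} (hT : IsSemigroupOf E T) : IsInvariantSet T hA := by
  intro t _ u
  refine hT.apply_comm hE.isClosedForm hE.dense (Q := restrictL hA) ?_ t u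
  choose P hP hPE using hE.restrictL_mem hreg (hA := hA) h1 hz
  have hPP : ∀ u, P (P u) = P u := fun u => Subtype.ext (by
    rw [hP, hP, restrictL_restrictL])
  have hPadd : ∀ u v, P (u + v) = P u + P v := fun u v => Subtype.ext (by
    rw [hP, Submodule.coe_add, Submodule.coe_add, map_add, hP, hP])
  have hPsmul : ∀ (c : ℝ) u, P (c • u) = c • P u := fun c u => Subtype.ext (by
    rw [hP, Submodule.coe_smul, Submodule.coe_smul, map_smul, hP])
  -- The energy of `P u + s (v - P v)` is at least that of `P u` for all `s`.
  have horth : ∀ u v, E (P u) (v - P v) = 0 := fun u v => by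
    have hquad : ∀ s : ℝ, 0 ≤ 2 * E (P u) (v - P v) * s + E (v - P v) (v - P v) * s ^ 2 := by
      intro s
      have e : P (P u + s • (v - P v)) = P u := by
        rw [hPadd, hPsmul, hPP]
        have : P (v - P v) = 0 := by
          rw [sub_eq_add_neg, hPadd, ← neg_one_smul ℝ (P v), hPsmul, hPP]
          simp
        rw [this, smul_zero, add_zero]
      have h := hPE (P u + s • (v - P v))
      rw [e] at h
      generalize v - P v = q at h ⊢
      simp only [map_add, LinearMap.add_apply, map_smul, LinearMap.smul_apply, smul_eq_mul,
        hE.symm q (P u)] at h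
      nlinarith
    have hd := discrim_le_zero (a := E (v - P v) (v - P v)) (b := 2 * E (P u) (v - P v)) (c := 0)
      fun s => by nlinarith [hquad s]
    rw [discrim] at hd
    nlinarith [sq_nonneg (E (P u) (v - P v))]
  have hPE' : ∀ u v, E (P u) v = E u (P v) := fun u v => by
    have h2 := horth u v
    have h3 := horth v u
    rw [map_sub, sub_eq_zero] at h2 h3
    rw [h2, hE.symm (P u), ← h3, hE.symm]
  rintro u f ⟨hu, hf⟩
  have e := hP ⟨u, hu⟩
  dsimp only at e
  refine ⟨e ▸ (P ⟨u, hu⟩).2, fun v => ?_⟩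
  have e' : (⟨restrictL hA u, e ▸ (P ⟨u, hu⟩).2⟩ : D) = P ⟨u, hu⟩ := Subtype.ext e.symm
  rw [e', hPE', hf, hP, inner_restrictL]

end Invariance

/-! ### The form `(1 + δ) B - A` -/

section Algebra

variable {X : Type*} [MeasurableSpace X] {m : Measure X} {D : Submodule ℝ (L2 m)}
  {A B : LinearMap.BilinForm ℝ D} {δ : ℝ}

theorem combination_apply (u v : D) : ((1 + δ) • B - A) u v = (1 + δ) * B u v - A u v := rfl

theorem GeneratorGraph.combination {u : L2 m} (hA : GeneratorGraph A u 0)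
    (hB : GeneratorGraph B u 0) : GeneratorGraph ((1 + δ) • B - A) u 0 := by
  refine ⟨hA.1, fun v => ?_⟩
  rw [combination_apply, hA.2, hB.2]
  simp

theorem isClosedForm_combination (hA : IsClosedForm A) (hB : IsClosedForm B)
    (hAB : ∀ u : D, A u u ≤ B u u) (hδ : 0 < δ) : IsClosedForm ((1 + δ) • B - A) where
  symm u v := by rw [combination_apply, combination_apply, hA.symm, hB.symm]
  nonneg u := by
    rw [combination_apply]
    nlinarith [hAB u, hB.nonneg u]
  closed u hu := by
    -- Both `E₁ ≤ (1 + δ) B₁` and `min δ 1 * B₁ ≤ E₁`.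
    have hle : ∀ v : D, min δ 1 * energyOne B v ≤ energyOne ((1 + δ) • B - A) v := fun v => by
      rw [energyOne, energyOne, combination_apply, mul_add]
      have h1 : min δ 1 * B v v ≤ δ * B v v :=
        mul_le_mul_of_nonneg_right (min_le_left _ _) (hB.nonneg v)
      have h2 : min δ 1 * ‖(v : L2 m)‖ ^ 2 ≤ 1 * ‖(v : L2 m)‖ ^ 2 :=
        mul_le_mul_of_nonneg_right (min_le_right _ _) (sq_nonneg _)
      linarith [hAB v]
    have hpos : 0 < min δ 1 := lt_min hδ one_pos
    obtain ⟨w, hw⟩ := hB.closed u fun ε hε => by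
      obtain ⟨N, hN⟩ := hu (min δ 1 * ε) (mul_pos hpos hε)
      exact ⟨N, fun i hi j hj => lt_of_mul_lt_mul_left ((hle _).trans_lt (hN i hi j hj)) hpos.le⟩
    refine ⟨w, squeeze_zero (fun i => ?_) (fun i => ?_) (by simpa using hw.const_mul (1 + δ))⟩
    · exact (mul_nonneg hpos.le (hB.energyOne_nonneg _)).trans (hle _)
    · rw [energyOne, energyOne, combination_apply]
      nlinarith [hA.nonneg (u i - w), mul_nonneg hδ.le (sq_nonneg ‖((u i - w : D) : L2 m)‖)]

theorem energyOne_combination_le (hA : IsClosedForm A) (hδ : 0 < δ) (u : D) :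
    energyOne ((1 + δ) • B - A) u ≤ (1 + δ) * energyOne B u := by
  rw [energyOne, energyOne, combination_apply]
  nlinarith [hA.nonneg u, mul_nonneg hδ.le (sq_nonneg ‖(u : L2 m)‖)]

end Algebra

section Combination

variable {X : Type*} [TopologicalSpace X] [CompactSpace X] [MeasurableSpace X] [BorelSpace X]
  {m : Measure X} [IsFiniteMeasure m] {D : Submodule ℝ (L2 m)} {A B : LinearMap.BilinForm ℝ D}
  {δ : ℝ}

/-- The unit contraction operates on `(1 + δ) B - A`. For `u` in the core, with truncation `v`,
both `A(v, u - v)` and `B(v, u - v)` vanish, whence `E(u) = E(v) + E(u - v)`; lower semicontinuity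
extends the inequality `E(v) ≤ E(u)` to the whole domain. -/
theorem markov_combination (hA : IsLocalRegularConservativeIrreducible A)
    (hB : IsLocalRegularConservativeIrreducible B)
    (hAB : ∀ u : D, A u u ≤ B u u) (hδ : 0 < δ) (u : D) : ∃ v : D,
    (∀ᵐ x ∂m, (v : L2 m) x = min (max 0 ((u : L2 m) x)) 1) ∧
      ((1 + δ) • B - A) v v ≤ ((1 + δ) • B - A) u u := by
  have hE := isClosedForm_combination hA.isDirichletForm.isClosedForm
    hB.isDirichletForm.isClosedForm hAB hδ
  obtain ⟨v, hv, -⟩ := hB.isDirichletForm.markov u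
  refine ⟨v, hv, ?_⟩
  have hA1 := hA.isConservative.generatorGraph_const
  have hB1 := hB.isConservative.generatorGraph_const
  obtain ⟨w, f, hwf, hw⟩ := hB.isRegular.exists_seq u
  have hlim : Tendsto (fun n => energyOne ((1 + δ) • B - A) (u - w n)) atTop (𝓝 0) := by
    refine squeeze_zero (fun n => hE.energyOne_nonneg _) (fun n =>
      (energyOne_combination_le hA.isDirichletForm.isClosedForm hδ _).trans
        (mul_le_mul_of_nonneg_left (hw n).le (by linarith))) ?_
    simpa using tendsto_one_div_add_atTop_nhds_zero_nat.const_mul (1 + δ)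
  obtain ⟨hL2, hen, -⟩ := hE.tendsto_of_energyOne hlim
  choose p hp _ using fun n => hB.isDirichletForm.toL2_clamp_mem hB1 (a := 0) one_pos (hwf n)
  have hpE : ∀ n, ((1 + δ) • B - A) (p n) (p n) ≤ ((1 + δ) • B - A) (w n) (w n) := fun n => by
    have h0 : ((1 + δ) • B - A) (p n) (w n - p n) = 0 := by
      rw [combination_apply,
        energy_clamp_sub_eq_zero hA.isDirichletForm hA1 hA.isLocal (hwf n) (hp n),
        energy_clamp_sub_eq_zero hB.isDirichletForm hB1 hB.isLocal (hwf n) (hp n)]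
      simp
    have h1 := hE.nonneg (w n - p n)
    have h2 := hE.symm (p n) (w n)
    generalize (1 + δ) • B - A = E at h0 h1 h2 ⊢
    simp only [map_sub, LinearMap.sub_apply] at h0 h1
    linarith
  have hpL2 : Tendsto (fun n => (p n : L2 m)) atTop (𝓝 (v : L2 m)) := by
    rw [tendsto_iff_norm_sub_tendsto_zero] at hL2 ⊢
    refine squeeze_zero (fun _ => norm_nonneg _) (fun n => ?_) hL2
    refine Lp.norm_le_norm_of_ae_le ?_
    filter_upwards [Lp.coeFn_sub (p n : L2 m) (v : L2 m), Lp.coeFn_sub (w n : L2 m) (u : L2 m), hv,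
      toL2_coeFn (m := m) (f n), toL2_coeFn (m := m) (clamp 0 1 (f n))] with x h1 h2 h3 h4 h5
    rw [h1, h2, Pi.sub_apply, Pi.sub_apply, hp, h5, h3, hwf, h4, Real.norm_eq_abs, Real.norm_eq_abs]
    change |min (max 0 (f n x)) (0 + 1) - _| ≤ _
    rw [zero_add]
    refine (abs_min_sub_min_le_max _ _ _ _).trans ?_
    rw [sub_self, abs_zero, max_eq_left (abs_nonneg _)]
    refine (abs_max_sub_max_le_max _ _ _ _).trans ?_
    rw [sub_self, abs_zero, max_eq_right (abs_nonneg _)]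
  refine le_of_forall_pos_le_add fun ε hε => hE.le_of_tendsto hpL2 ?_
  filter_upwards [hen.eventually_le_const (lt_add_of_pos_right _ hε)] with n hn
  exact (hpE n).trans hn

theorem isDirichletForm_combination (hA : IsLocalRegularConservativeIrreducible A)
    (hB : IsLocalRegularConservativeIrreducible B)
    (hAB : ∀ u : D, A u u ≤ B u u) (hδ : 0 < δ) : IsDirichletForm ((1 + δ) • B - A) :=
  have hE := isClosedForm_combination hA.isDirichletForm.isClosedForm
    hB.isDirichletForm.isClosedForm hAB hδ
  ⟨hB.isDirichletForm.dense, hE.symm, hE.nonneg, hE.closed, markov_combination hA hB hAB hδ⟩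

theorem isRegular_combination (hA : IsClosedForm A) (hB : IsRegular B) (hδ : 0 < δ) :
    IsRegular ((1 + δ) • B - A) := by
  obtain ⟨C, hC⟩ := hB
  refine ⟨C, hC.mem_domain, fun u ε hε => ?_, hC.dense_continuous⟩
  have hpos : 0 < 1 + δ := by linarith
  obtain ⟨v, hv, hlt⟩ := hC.dense_domain u (ε / (1 + δ)) (by positivity)
  refine ⟨v, hv, (energyOne_combination_le hA hδ _).trans_lt ?_⟩
  rwa [lt_div_iff₀' hpos] at hlt

/-- An invariant set of the combined form has an indicator without energy, hence without
`B`-energy because `δ B ≤ E`, and is thus invariant for `B`. -/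
theorem isIrreducible_combination (hA : IsLocalRegularConservativeIrreducible A)
    (hB : IsLocalRegularConservativeIrreducible B)
    (hAB : ∀ u : D, A u u ≤ B u u) (hδ : 0 < δ) {T : ℝ≥0 → L2 m →L[ℝ] L2 m}
    (hT : IsSemigroupOf ((1 + δ) • B - A) T) : IsIrreducible ((1 + δ) • B - A) := by
  refine ⟨T, hT, fun S hS hinv => ?_⟩
  have hB1 := hB.isConservative.generatorGraph_const
  have hE1 := hA.isConservative.generatorGraph_const.combination (δ := δ) hB1
  have hz : GeneratorGraph ((1 + δ) • B - A) (restrictL hS (Lp.const 2 m (1 : ℝ))) 0 := by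
    refine (hT.generator _ _).1 (tendsto_const_nhds.congr' ?_)
    filter_upwards [self_mem_nhdsWithin] with t ht
    have h : T t (restrictL hS (Lp.const 2 m (1 : ℝ))) =
        restrictL hS (T t (Lp.const 2 m (1 : ℝ))) := hinv t ht _
    rw [h, hT.apply_eq_self hE1, sub_self, smul_zero]
  have hBc := hB.isDirichletForm.isClosedForm
  have hzB : B ⟨_, hz.1⟩ ⟨_, hz.1⟩ = 0 := by
    have h := hz.2 ⟨_, hz.1⟩
    rw [combination_apply, inner_zero_left, neg_zero] at h
    have h2 := hAB ⟨_, hz.1⟩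
    have h3 := hBc.nonneg ⟨_, hz.1⟩
    nlinarith
  have hzB' : GeneratorGraph B (restrictL hS (Lp.const 2 m (1 : ℝ))) 0 := by
    refine ⟨hz.1, fun v => ?_⟩
    rw [inner_zero_left, neg_zero]
    have h := LinearMap.BilinForm.apply_sq_le_of_symm B hBc.nonneg ⟨hBc.symm⟩ ⟨_, hz.1⟩ v
    rw [hzB, zero_mul] at h
    exact pow_eq_zero_iff two_ne_zero |>.1 (h.antisymm (sq_nonneg _))
  obtain ⟨TB, hTB, hirr⟩ := hB.isIrreducible
  exact hirr S hS (isInvariantSet_of_generatorGraph hB.isDirichletForm hB.isRegular hB1 hzB' hTB)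

end Combination

end DirichletForms

theorem mainTheorem9 {F : Type*} [MetricSpace F] [CompactSpace F] [MeasurableSpace F]
    [BorelSpace F] (m : Measure F) [IsFiniteMeasure m] (D : Submodule ℝ (DirichletForms.L2 m))
    (A B : LinearMap.BilinForm ℝ D)
    (hA : DirichletForms.IsLocalRegularConservativeIrreducible A)
    (hB : DirichletForms.IsLocalRegularConservativeIrreducible B)
    (hAB : ∀ u : D, A u u ≤ B u u) (δ : ℝ) (hδ : 0 < δ) :
    DirichletForms.IsLocalRegularConservativeIrreducible ((1 + δ) • B - A) := by
  have hD := DirichletForms.isDirichletForm_combination hA hB hAB hδ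
  obtain ⟨T, hT⟩ := hD.isClosedForm.exists_isSemigroupOf hD.dense
  refine ⟨hD, fun u v hu hv huv => ?_,
    DirichletForms.isRegular_combination hA.isDirichletForm.isClosedForm hB.isRegular hδ,
    ⟨T, hT, fun t _ => hT.apply_eq_self (hA.isConservative.generatorGraph_const.combination
      hB.isConservative.generatorGraph_const) t⟩,
    DirichletForms.isIrreducible_combination hA hB hAB hδ hT⟩
  rw [DirichletForms.combination_apply, hA.isLocal u v hu hv huv, hB.isLocal u v hu hv huv]
  simp
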